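/- Let $D=\mathbb{C}$ or $D=\{|z|<R\}$ for some $R>0$, and let $f(z,w)=(p(z),q(z,w))$ be a holomorphic skew product on $D\times\mathbb{C}$ with a superattracting (nilpotent) fixed point at the origin: $p(z)=az^{\delta}+O(z^{\delta+1})$ with $a\neq 0$, $\delta\ge 2$, and near the origin $q(z,w)=\sum_{i,j\ge 0}b_{ij}z^iw^j$ with $b_{00}=b_{01}=0$. Let $A_p$ be the set of $z\in D$ all of whose iterates $p^n(z)$ are defined and tend to $0$; if $D=\{|z|<R\}$, assume that $A_p$ is relatively compact in $D$. Let $A_0$ be the set of $(z,w)\in D\times\mathbb{C}$ all of whose iterates $(z_n,w_n)=f^n(z,w)$ are defined and tend to the origin. With $\log 0=-\infty$, put $$G_p(z)=\lim_{n\to\infty}\delta^{-n}\log|p^n(z)|\in[-\infty,\infty).$$ Let $N(q)$ be the convex hull of the union of the quadrants $\{(x,y)\in\mathbb{R}^2: x\ge i,\ y\ge j\}$ over all $(i,j)$ with $b_{ij}\ne 0$; let $(n_1,m_1),\dots,(n_s,m_s)$ be its vertices, with $n_1<\cdots<n_s$ and $m_1>\cdots>m_s$; and for $1\le j\le s-1$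 let $T_j$ be the $y$-intercept of the line through $(n_j,m_j)$ and $(n_{j+1},m_{j+1})$. Suppose that $s>2$ and that $T_k\le\delta\le T_{k-1}$ for some $2\le k\le s-1$ (Case 4). Put $(\gamma,d)=(n_k,m_k)$ (then $\gamma>0$ and $\delta>d\geq 1$), $\alpha=\gamma/(\delta-d)$, $\lambda=\max\{\delta,d\}$, $$l_1=\frac{n_k-n_{k-1}}{m_{k-1}-m_k},\qquad l_1+l_2=\frac{n_{k+1}-n_k}{m_k-m_{k+1}},$$ $$U=U_r=\{|z|^{l_1+l_2}<r^{l_2}|w|,\ |w|<r|z|^{l_1}\},$$ and let $A_f=A_f(r)$ be the union of all the preimages of $U_r$ under the iterates of $f$. Put $$G_z(w)=\lim_{n\to\infty}\lambda^{-n}\log|w_n|,\qquad G_f^{\alpha}(z,w)=\lim_{n\to\infty}\lambda^{-n}\log\max\{|z_n|^{\alpha},|w_n|\}.$$ Then the limit $G_p$ exists on $A_p$, and: 1. If $d\ge 2$ or $T_k<\delta<T_{k-1}$, then for every sufficiently small $r>0$, $A_f\subset A_p\times\mathbb{C}$, and for every $(z,w)\in A_f$ the limit $G_z(w)$ exists and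 equals $\alpha G_p(z)$. 2. If $(n_1,m_1)\ne(0,\delta)$, then for every $(z,w)\in A_0$ the limit $G_f^{\alpha}(z,w)$ exists and equals $\alpha G_p(z)$ (both sides may be $-\infty$). -/

import Mathlib

open Filter Topology

noncomputable section

namespace SkewProduct

/-- The skew product `f(z, w) = (p(z), q(z, w))`. -/
def skew (p : ℂ → ℂ) (q : ℂ × ℂ → ℂ) (x : ℂ × ℂ) : ℂ × ℂ := (p x.1, q x)

/-- The attracting basin `A_p` of `p` at the origin, for `p` defined on `D`: the points all of
whose iterates are defined, and converge to `0`. -/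
def basinP (D : Set ℂ) (p : ℂ → ℂ) : Set ℂ :=
  {z | (∀ n : ℕ, p^[n] z ∈ D) ∧ Tendsto (fun n : ℕ => p^[n] z) atTop (𝓝 0)}

/-- The attracting basin `A_0` of `f` at the origin, for `f` defined on `D × ℂ`. -/
def basin (D : Set ℂ) (p : ℂ → ℂ) (q : ℂ × ℂ → ℂ) : Set (ℂ × ℂ) :=
  {x | (∀ n : ℕ, ((skew p q)^[n] x).1 ∈ D) ∧
    Tendsto (fun n : ℕ => (skew p q)^[n] x) atTop (𝓝 0)}

/-- The union of all the preimages of `U` under the iterates of `f`, for `f` defined on `D × ℂ`. -/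
def preimages (D : Set ℂ) (p : ℂ → ℂ) (q : ℂ × ℂ → ℂ) (U : Set (ℂ × ℂ)) : Set (ℂ × ℂ) :=
  {x | ∃ n : ℕ, (∀ j ≤ n, ((skew p q)^[j] x).1 ∈ D) ∧ (skew p q)^[n] x ∈ U}

/-- `f = (p, q)` is a holomorphic skew product on `D × ℂ`, where `D` is the whole plane, or a disc
in which the basin `A_p` is relatively compact; `p(z) = a z ^ δ + O(z ^ (δ + 1))` with `a ≠ 0` and
`δ ≥ 2`; `q(z, w) = ∑ b i j z ^ i w ^ j` near the origin; `f` fixes the origin (`b 0 0 = 0`) and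
both eigenvalues of `Df(0)` vanish (`δ ≥ 2` and `b 0 1 = 0`). -/
structure IsSuperattracting (D : Set ℂ) (p : ℂ → ℂ) (q : ℂ × ℂ → ℂ)
    (a : ℂ) (δ : ℕ) (b : ℕ → ℕ → ℂ) : Prop where
  domain : D = Set.univ ∨
    ∃ R : ℝ, 0 < R ∧ D = Metric.ball 0 R ∧ closure (basinP D p) ⊆ Metric.ball 0 R
  holo_p : DifferentiableOn ℂ p D
  holo_q : DifferentiableOn ℂ q (D ×ˢ Set.univ)
  lead_ne : a ≠ 0
  two_le : 2 ≤ δ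
  expand_p : (fun z : ℂ => p z - a * z ^ δ) =O[𝓝 0] (fun z : ℂ => z ^ (δ + 1))
  expand_q : ∀ᶠ x : ℂ × ℂ in 𝓝 0,
    HasSum (fun ij : ℕ × ℕ => b ij.1 ij.2 * x.1 ^ ij.1 * x.2 ^ ij.2) (q x)
  fix_zero : b 0 0 = 0
  nilpotent : b 0 1 = 0

/-- The Newton polygon `N(q)`: the convex hull of the union of the quadrants
`{(x, y) | x ≥ i, y ≥ j}` over all `(i, j)` with `b i j ≠ 0`. -/
def newtonPolygon (b : ℕ → ℕ → ℂ) : Set (ℝ × ℝ) :=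
  convexHull ℝ {v : ℝ × ℝ | ∃ i j : ℕ, b i j ≠ 0 ∧ (i : ℝ) ≤ v.1 ∧ (j : ℝ) ≤ v.2}

/-- `(n 1, m 1), …, (n s, m s)` are the vertices of `N(q)`, in the order
`n 1 < ⋯ < n s` and `m 1 > ⋯ > m s` (other values of `n` and `m` are irrelevant). -/
structure IsVertices (b : ℕ → ℕ → ℂ) (s : ℕ) (n m : ℕ → ℕ) : Prop where
  vertices : (newtonPolygon b).extremePoints ℝ =
    (fun k : ℕ => (((n k : ℕ) : ℝ), ((m k : ℕ) : ℝ))) '' Set.Icc 1 s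
  strictMono : StrictMonoOn n (Set.Icc 1 s)
  strictAnti : StrictAntiOn m (Set.Icc 1 s)

/-- `T_k`: the `y`-intercept of the line through `(n k, m k)` and `(n (k+1), m (k+1))`. -/
def intercept (n m : ℕ → ℕ) (k : ℕ) : ℝ :=
  (m k : ℝ) + (n k : ℝ) * (((m k : ℝ) - m (k + 1)) / ((n (k + 1) : ℝ) - n k))

/-- The number `(n (k+1) - n k) / (m k - m (k+1))`, that is `-1 / slope` of the line through
`(n k, m k)` and `(n (k+1), m (k+1))`. -/
def edgeWeight (n m : ℕ → ℕ) (k : ℕ) : ℝ :=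
  ((n (k + 1) : ℝ) - n k) / ((m k : ℝ) - m (k + 1))

/-- `l₁` at the vertex `k`. -/
def weightOne (n m : ℕ → ℕ) (k : ℕ) : ℝ := edgeWeight n m (k - 1)

/-- `l₂` at the vertex `k`, defined by
`l₁ + l₂ = (n (k+1) - n k) / (m k - m (k+1))`. -/
def weightTwo (n m : ℕ → ℕ) (k : ℕ) : ℝ := edgeWeight n m k - weightOne n m k

/-- The wedge `U = {|z| ^ (l₁ + l₂) < r ^ l₂ |w|, |w| < r |z| ^ l₁}`. -/
def wedge (l₁ l₂ r : ℝ) : Set (ℂ × ℂ) :=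
  {x | ‖x.1‖ ^ (l₁ + l₂) < r ^ l₂ * ‖x.2‖ ∧ ‖x.2‖ < r * ‖x.1‖ ^ l₁}

/-- The weight `α = γ / (δ - d)`. -/
def alpha (γ d δ : ℕ) : ℝ := (γ : ℝ) / ((δ : ℝ) - d)

/-- The logarithm of a non-negative real, with `log 0 = -∞`. -/
def elog (t : ℝ) : EReal := ENNReal.log (ENNReal.ofReal t)

/-- The sequence `δ ^ (-N) log |p ^ N (z)|`. -/
def seqP (p : ℂ → ℂ) (δ : ℕ) (z : ℂ) (N : ℕ) : EReal :=
  ((((δ : ℝ) ^ N)⁻¹ : ℝ) : EReal) * elog ‖p^[N] z‖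

/-- `G_p`, the limit of `δ ^ (-N) log |p ^ N (z)|`. -/
def greenP (p : ℂ → ℂ) (δ : ℕ) (z : ℂ) : EReal := limUnder atTop (seqP p δ z)

/-- The sequence `lam ^ (-N) log |w_N|` whose limit is `G_z`, where `(z_N, w_N) = f ^ N (z, w)`
and `lam = max {δ, d}`. -/
def seqZ (p : ℂ → ℂ) (q : ℂ × ℂ → ℂ) (δ d : ℕ) (x : ℂ × ℂ) (N : ℕ) : EReal :=
  (((((max δ d : ℕ) : ℝ) ^ N)⁻¹ : ℝ) : EReal) * elog ‖((skew p q)^[N] x).2‖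

/-- The sequence `lam ^ (-N) log |(z_N ^ α, w_N)|` whose limit is `G_f ^ α`, where
`|(z, w)| = max {|z|, |w|}`, `(z_N, w_N) = f ^ N (z, w)` and `lam = max {δ, d}`. -/
def seqF (p : ℂ → ℂ) (q : ℂ × ℂ → ℂ) (δ d : ℕ) (α : ℝ) (x : ℂ × ℂ) (N : ℕ) : EReal :=
  (((((max δ d : ℕ) : ℝ) ^ N)⁻¹ : ℝ) : EReal) *
    elog (max (‖((skew p q)^[N] x).1‖ ^ α) ‖((skew p q)^[N] x).2‖)

end SkewProduct

end

open SkewProduct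

/-!
Write `X = -log |z|` and `Y = -log |w|`. Near the origin `p` acts on `X` as multiplication by `δ` up
to a bounded error, and a monomial `z ^ i * w ^ j` becomes the linear form `i X + j Y`. The whole
argument is about which of these linear forms, over the support of the series of `q`, is smallest.

The hypothesis `T_k ≤ δ ≤ T_{k-1}` says that `α = γ / (δ - d)` lies between the weights of the two
edges adjacent to the vertex `(γ, d)`. By convexity this vertex minimises `i + t j` on the support
for every `t` between these weights (`IsVertices.le_of_edgeWeight`); for `t = α` the minimum is
`γ + α d = α δ`.

*The wedge.* In logarithmic coordinates the wedge lies between the two lines normal to the edges, at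
a distance which grows with `-log r`, so `b γ d * z ^ γ * w ^ d` dominates `q`
(`exists_abs_log_sub_monomial_le`). The linear map `(X, Y) ↦ (δ X, γ X + d Y)` preserves the
wedge; when `d ≥ 2` or both inequalities on `δ` are strict, it does so strictly enough to absorb
bounded errors for small `r`
(`IsSuperattracting.exists_wedge_invariant`). Since `γ + α d = α δ`, the difference `Y - α X` is
multiplied by `d` at each step, up to a bounded error; as `d < δ`, it is negligible compared to
`δ ^ N`.

*The basin.* Only the upper bound for `log |w_N|` needs an argument. Let `β < α`. Since
`i + α j ≥ α δ` on the support and `(0, δ)` is not in the support, there is `κ > 1` such that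
`i + β j ≥ δ κ β` on the support (`exists_one_lt_mul_le`). Hence `M = min Y (β X)` is at least
multiplied by `δ κ` at each step (up to a bounded error, negligible as `M → ∞`) for as long as it is
less than `β X`, which only grows like `δ ^ N`. Therefore `Y ≥ β X` eventually, up to a constant
(`eventually_eq_of_growth`, `IsSuperattracting.eventually_log_le`), and `β` tends to `α`.
On orbits which land in `{z = 0}` the series starts at `w ^ (δ + 1)` at the earliest, and both sides
are `-∞`.
-/

namespace SkewProduct

/-! ### Vertices of the Newton polygon -/

section NewtonPolygon

variable {b : ℕ → ℕ → ℂ} {s : ℕ} {n m : ℕ → ℕ}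

theorem mem_newtonPolygon_of_ne {i j : ℕ} (h : b i j ≠ 0) {v : ℝ × ℝ} (h₁ : (i : ℝ) ≤ v.1)
    (h₂ : (j : ℝ) ≤ v.2) : v ∈ newtonPolygon b :=
  subset_convexHull ℝ _ ⟨i, j, h, h₁, h₂⟩

theorem add_mem_newtonPolygon {v u : ℝ × ℝ} (hv : v ∈ newtonPolygon b) (h₁ : 0 ≤ u.1)
    (h₂ : 0 ≤ u.2) : v + u ∈ newtonPolygon b := by
  have hc : Convex ℝ ((fun v : ℝ × ℝ => v + u) ⁻¹' newtonPolygon b) :=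
    (convex_convexHull ℝ _).translate_preimage_left u
  refine convexHull_min ?_ hc hv
  rintro v ⟨i, j, hb, hi, hj⟩
  exact mem_newtonPolygon_of_ne hb (by simpa using by linarith) (by simpa using by linarith)

/-- A point of the Newton polygon lying strictly inside a segment of points of the polygon,
or above it, is not a vertex. -/
theorem not_mem_extremePoints_newtonPolygon {v u x : ℝ × ℝ} (hv : v ∈ newtonPolygon b)
    (hu : u ∈ newtonPolygon b) (hne : v ≠ u) {t : ℝ} (ht₀ : 0 < t) (ht₁ : t < 1)
    (hx₁ : x.1 = t * v.1 + (1 - t) * u.1) (hx₂ : t * v.2 + (1 - t) * u.2 ≤ x.2) :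
    x ∉ (newtonPolygon b).extremePoints ℝ := by
  intro hx
  rw [mem_extremePoints] at hx
  obtain ⟨-, hx⟩ := hx
  set h : ℝ := x.2 - (t * v.2 + (1 - t) * u.2) with hh
  have key := hx (v + (0, h)) (add_mem_newtonPolygon hv le_rfl (by simp [hh]; linarith))
    (u + (0, h)) (add_mem_newtonPolygon hu le_rfl (by simp [hh]; linarith))
    ⟨t, 1 - t, ht₀, by linarith, by ring, by
      ext
      · simp [hx₁]
      · simp [hh]; ring⟩
  exact hne (add_right_cancel (key.1.trans key.2.symm))

theorem IsVertices.vertex_mem (hv : IsVertices b s n m) {j : ℕ} (h₁ : 1 ≤ j) (h₂ : j ≤ s) :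
    ((n j : ℝ), (m j : ℝ)) ∈ (newtonPolygon b).extremePoints ℝ := by
  rw [hv.vertices]
  exact ⟨j, ⟨h₁, h₂⟩, rfl⟩

theorem IsVertices.coeff_ne_zero (hv : IsVertices b s n m) {j : ℕ} (h₁ : 1 ≤ j) (h₂ : j ≤ s) :
    b (n j) (m j) ≠ 0 := by
  have hx := hv.vertex_mem h₁ h₂
  obtain ⟨i, l, hb, hi, hl⟩ := extremePoints_convexHull_subset hx
  simp only at hi hl
  -- otherwise `(n j, m j)` is the midpoint of `(i, l)` and its reflection
  have key := (mem_extremePoints.1 hx).2 ((i : ℝ), (l : ℝ))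
    (mem_newtonPolygon_of_ne hb le_rfl le_rfl) (2 * (n j : ℝ) - i, 2 * (m j : ℝ) - l)
    (mem_newtonPolygon_of_ne hb (by simp only; linarith) (by simp only; linarith))
    ⟨1 / 2, 1 / 2, by norm_num, by norm_num, by norm_num, by
      ext
      · simp only [Prod.fst_add, Prod.smul_fst, smul_eq_mul]; ring
      · simp only [Prod.snd_add, Prod.smul_snd, smul_eq_mul]; ring⟩
  have h := key.1
  simp only [Prod.mk.injEq, Nat.cast_inj] at h
  rwa [h.1, h.2] at hb

/-- The vertices of the Newton polygon are in convex position. -/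
theorem IsVertices.cross_lt (hv : IsVertices b s n m) {i j l : ℕ} (hi : 1 ≤ i) (hij : i < j)
    (hjl : j < l) (hl : l ≤ s) :
    ((n j : ℝ) - n i) * ((m j : ℝ) - m l) < ((n l : ℝ) - n j) * ((m i : ℝ) - m j) := by
  have hi' : i ∈ Set.Icc 1 s := ⟨hi, by omega⟩
  have hj' : j ∈ Set.Icc 1 s := ⟨by omega, by omega⟩
  have hl' : l ∈ Set.Icc 1 s := ⟨by omega, by omega⟩
  have h₁ : (n i : ℝ) < n j := by exact_mod_cast hv.strictMono hi' hj' hij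
  have h₂ : (n j : ℝ) < n l := by exact_mod_cast hv.strictMono hj' hl' hjl
  by_contra! hcon
  have hpos : (0 : ℝ) < n l - n i := by linarith
  refine not_mem_extremePoints_newtonPolygon
    (hv.vertex_mem hi'.1 hi'.2).1 (hv.vertex_mem hl'.1 hl'.2).1 ?_
    (t := ((n l : ℝ) - n j) / (n l - n i)) (by apply div_pos <;> linarith)
    (by rw [div_lt_one hpos]; linarith) ?_ ?_ (hv.vertex_mem hj'.1 hj'.2)
  · intro h
    have := congrArg Prod.fst h
    simp only at this
    linarith
  · simp only
    field_simp
    ring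
  · simp only
    have : ((n l : ℝ) - n j) / (n l - n i) * m i + (1 - ((n l : ℝ) - n j) / (n l - n i)) * m l
      = (((n l : ℝ) - n j) * m i + (n j - n i) * m l) / (n l - n i) := by
      field_simp
      ring
    rw [this, div_le_iff₀ hpos]
    nlinarith

/-- A linear form with positive coefficients attains its minimum on the support of the series
at a vertex: among the minimisers, the leftmost one is an extreme point of the polygon. -/
theorem IsVertices.le_of_forall_vertex (hv : IsVertices b s n m) {t c : ℝ} (ht : 0 < t)
    (h : ∀ j, 1 ≤ j → j ≤ s → c ≤ n j + t * m j) {i j : ℕ} (hb : b i j ≠ 0) :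
    c ≤ i + t * j := by
  classical
  set v₀ : ℝ := i + t * j with hv₀
  have hv₀0 : 0 ≤ v₀ := by positivity
  set F : Finset (ℕ × ℕ) := (Finset.range (⌈v₀⌉₊ + 1) ×ˢ Finset.range (⌈v₀ / t⌉₊ + 1)).filter
    (fun e => b e.1 e.2 ≠ 0) with hF
  have hmemF : ∀ i' j' : ℕ, b i' j' ≠ 0 → (i' : ℝ) + t * j' ≤ v₀ → (i', j') ∈ F := by
    intro i' j' hb' hle
    have h0 : (0 : ℝ) ≤ i' := by positivity
    have h1 : (0 : ℝ) ≤ t * j' := by positivity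
    simp only [hF, Finset.mem_filter, Finset.mem_product, Finset.mem_range]
    refine ⟨⟨Nat.lt_succ_of_le ?_, Nat.lt_succ_of_le ?_⟩, hb'⟩
    · exact_mod_cast (by linarith : (i' : ℝ) ≤ v₀).trans (Nat.le_ceil v₀)
    · exact_mod_cast ((le_div_iff₀ ht).2 (by linarith) : (j' : ℝ) ≤ v₀ / t).trans
        (Nat.le_ceil _)
  -- the second component breaks ties in favour of the leftmost minimiser
  obtain ⟨⟨i₀, j₀⟩, h₀F, h₀⟩ := F.exists_min_image
    (fun e => toLex ((e.1 : ℝ) + t * e.2, e.1)) ⟨(i, j), hmemF i j hb le_rfl⟩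
  have hb₀ : b i₀ j₀ ≠ 0 := (Finset.mem_filter.1 h₀F).2
  have hmin : ∀ i' j' : ℕ, b i' j' ≠ 0 → (i₀ : ℝ) + t * j₀ < i' + t * j' ∨
      ((i₀ : ℝ) + t * j₀ = i' + t * j' ∧ i₀ ≤ i') := by
    intro i' j' hb'
    by_cases hle : (i' : ℝ) + t * j' ≤ v₀
    · have := h₀ _ (hmemF i' j' hb' hle)
      simpa [Prod.Lex.toLex_le_toLex] using this
    · left
      have := h₀ _ (hmemF i j hb le_rfl)
      rw [Prod.Lex.toLex_le_toLex] at this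
      simp only at this
      push Not at hle
      rcases this with h | h
      · linarith
      · linarith [h.1]
  -- the points lexicographically above `(i₀, j₀)` form a convex set containing the polygon
  set K : Set (ℝ × ℝ) := {v | (i₀ : ℝ) + t * j₀ < v.1 + t * v.2 ∨
      ((i₀ : ℝ) + t * j₀ = v.1 + t * v.2 ∧ (i₀ : ℝ) ≤ v.1)} with hK
  have hKc : Convex ℝ K := by
    intro v hv u hu x y hx hy hxy
    rcases hx.eq_or_lt with rfl | hx
    · have : y = 1 := by linarith
      simpa [this] using hu
    rcases hy.eq_or_lt with rfl | hy
    · have : x = 1 := by linarith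
      simpa [this] using hv
    have hx' : x = 1 - y := by linarith
    simp only [hK, Set.mem_ofPred_eq, Prod.fst_add, Prod.snd_add, Prod.smul_fst, Prod.smul_snd,
      smul_eq_mul] at hv hu ⊢
    have e : x * v.1 + y * u.1 + t * (x * v.2 + y * u.2) - (i₀ + t * j₀)
      = x * (v.1 + t * v.2 - (i₀ + t * j₀)) + y * (u.1 + t * u.2 - (i₀ + t * j₀)) := by
      rw [hx']; ring
    rcases hv with hv | ⟨hv, hv'⟩ <;> rcases hu with hu | ⟨hu, hu'⟩
    · left
      have := mul_pos hx (sub_pos.2 hv)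
      have := mul_pos hy (sub_pos.2 hu)
      linarith
    · left
      have := mul_pos hx (sub_pos.2 hv)
      rw [← hu] at e
      linarith
    · left
      have := mul_pos hy (sub_pos.2 hu)
      rw [← hv] at e
      linarith
    · right
      rw [← hv, ← hu] at e
      have h1 := mul_nonneg hx.le (sub_nonneg.2 hv')
      have h2 := mul_nonneg hy.le (sub_nonneg.2 hu')
      refine ⟨by linarith, ?_⟩
      have : x * v.1 + y * u.1 - i₀ = x * (v.1 - i₀) + y * (u.1 - i₀) := by
        rw [hx']; ring
      linarith
  have hNK : newtonPolygon b ⊆ K := by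
    refine convexHull_min ?_ hKc
    rintro v ⟨i', j', hb', h1, h2⟩
    have h3 : t * j' ≤ t * v.2 := mul_le_mul_of_nonneg_left h2 ht.le
    rcases hmin i' j' hb' with h | ⟨h, h'⟩
    · left; linarith
    · have h' : (i₀ : ℝ) ≤ i' := by exact_mod_cast h'
      by_cases h4 : (i₀ : ℝ) + t * j₀ = v.1 + t * v.2
      · right; exact ⟨h4, by linarith⟩
      · left
        exact lt_of_le_of_ne (by linarith) h4
  have hext : ((i₀ : ℝ), (j₀ : ℝ)) ∈ (newtonPolygon b).extremePoints ℝ := by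
    rw [mem_extremePoints_iff_left]
    refine ⟨mem_newtonPolygon_of_ne hb₀ le_rfl le_rfl, ?_⟩
    rintro v hv u hu ⟨x, y, hx, hy, hxy, he⟩
    have hv := hNK hv
    have hu := hNK hu
    have e1 : x * v.1 + y * u.1 = i₀ := by simpa using congrArg Prod.fst he
    have e2 : x * v.2 + y * u.2 = j₀ := by simpa using congrArg Prod.snd he
    have hx' : x = 1 - y := by linarith
    have e : x * (v.1 + t * v.2 - (i₀ + t * j₀)) + y * (u.1 + t * u.2 - (i₀ + t * j₀)) = 0 := by
      have : x * (v.1 + t * v.2 - (i₀ + t * j₀)) + y * (u.1 + t * u.2 - (i₀ + t * j₀))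
        = (x * v.1 + y * u.1) + t * (x * v.2 + y * u.2) - (x + y) * (i₀ + t * j₀) := by ring
      rw [this, e1, e2, hxy]; ring
    have e' : x * (v.1 - i₀) + y * (u.1 - i₀) = 0 := by
      have : x * (v.1 - i₀) + y * (u.1 - i₀) = (x * v.1 + y * u.1) - (x + y) * i₀ := by ring
      rw [this, e1, hxy]; ring
    rcases hv with hv | ⟨hv, hv'⟩
    · have h1 := mul_pos hx (sub_pos.2 hv)
      have h2 : 0 ≤ y * (u.1 + t * u.2 - (i₀ + t * j₀)) := by
        apply mul_nonneg hy.le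
        rcases hu with hu | ⟨hu, -⟩ <;> linarith
      linarith
    · rcases hu with hu | ⟨hu, hu'⟩
      · have h1 := mul_pos hy (sub_pos.2 hu)
        rw [← hv] at e
        linarith
      · have h1 : 0 ≤ y * (u.1 - i₀) := mul_nonneg hy.le (by linarith)
        have h2 : v.1 = i₀ := by
          by_contra hne
          have : 0 < v.1 - i₀ := by
            have := lt_of_le_of_ne hv' (Ne.symm hne)
            linarith
          have := mul_pos hx this
          linarith
        refine Prod.ext h2 ?_
        have : t * v.2 = t * j₀ := by linarith
        exact mul_left_cancel₀ ht.ne' this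
  rw [hv.vertices] at hext
  obtain ⟨l, ⟨hl1, hl2⟩, hl⟩ := hext
  have hl' := h l hl1 hl2
  simp only [Prod.mk.injEq] at hl
  rw [hl.1, hl.2] at hl'
  rcases hmin i j hb with h | ⟨h, -⟩ <;> linarith

/-- Between the weights of the two edges adjacent to the vertex `k`, that vertex minimises the
corresponding linear form on the support of the series. -/
theorem IsVertices.le_of_edgeWeight (hv : IsVertices b s n m) {k : ℕ} (hk : 2 ≤ k) (hks : k + 1 ≤ s)
    {t : ℝ} (ht₁ : edgeWeight n m (k - 1) ≤ t) (ht₂ : t ≤ edgeWeight n m k) (ht : 0 < t)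
    {i j : ℕ} (hb : b i j ≠ 0) : (n k : ℝ) + t * m k ≤ i + t * j := by
  obtain ⟨e, rfl⟩ : ∃ e, k = e + 1 := ⟨k - 1, by omega⟩
  simp only [edgeWeight, Nat.add_sub_cancel] at ht₁ ht₂
  have hm : ∀ {i j : ℕ}, 1 ≤ i → i < j → j ≤ s → (m j : ℝ) < m i := by
    intro i j hi hij hj
    exact_mod_cast hv.strictAnti ⟨hi, by omega⟩ ⟨by omega, hj⟩ hij
  have hm₁ := hm (show 1 ≤ e by omega) (Nat.lt_succ_self e) (by omega)
  have hm₂ := hm (show 1 ≤ e + 1 by omega) (Nat.lt_succ_self (e + 1)) (by omega)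
  rw [div_le_iff₀ (by linarith)] at ht₁
  rw [le_div_iff₀ (by linarith)] at ht₂
  refine hv.le_of_forall_vertex ht (fun j hj₁ hj₂ => ?_) hb
  rcases lt_trichotomy j (e + 1) with hj | rfl | hj
  · rcases (Nat.lt_succ_iff.1 hj).eq_or_lt with rfl | hj
    · linarith
    · have h := hv.cross_lt hj₁ hj (Nat.lt_succ_self e) (by omega)
      have h' := hm hj₁ hj (by omega)
      have h₁ : (n e : ℝ) - n j < t * (m j - m e) := by
        have h3 : (0 : ℝ) < m e - m (e + 1) := by linarith
        have h4 : (0 : ℝ) < m j - m e := by linarith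
        have := mul_le_mul_of_nonneg_right ht₁ h4.le
        nlinarith
      linarith
  · exact le_rfl
  · rcases (Nat.succ_le_of_lt hj).eq_or_lt with rfl | hj
    · simp only [Nat.succ_eq_add_one]
      linarith
    · have h := hv.cross_lt (show 1 ≤ e + 1 by omega) (Nat.lt_succ_self (e + 1)) hj hj₂
      have h' := hm (by omega) hj hj₂
      simp only [Nat.succ_eq_add_one] at h h'
      have h₁ : t * (m (e + 1 + 1) - m j) < (n j : ℝ) - n (e + 1 + 1) := by
        have h3 : (0 : ℝ) < m (e + 1) - m (e + 1 + 1) := by linarith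
        have h4 : (0 : ℝ) < m (e + 1 + 1) - m j := by linarith
        have := mul_le_mul_of_nonneg_right ht₂ h4.le
        nlinarith
      linarith

theorem IsVertices.edgeWeight_pos (hv : IsVertices b s n m) {j : ℕ} (h₁ : 1 ≤ j)
    (h₂ : j + 1 ≤ s) : 0 < edgeWeight n m j := by
  have h3 : (n j : ℝ) < n (j + 1) := by
    exact_mod_cast hv.strictMono ⟨h₁, by omega⟩ ⟨by omega, h₂⟩ (Nat.lt_succ_self j)
  have h4 : (m (j + 1) : ℝ) < m j := by
    exact_mod_cast hv.strictAnti ⟨h₁, by omega⟩ ⟨by omega, h₂⟩ (Nat.lt_succ_self j)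
  exact div_pos (by linarith) (by linarith)

theorem IsVertices.weightTwo_pos (hv : IsVertices b s n m) {k : ℕ} (hk : 2 ≤ k)
    (hks : k + 1 ≤ s) : 0 < weightTwo n m k := by
  obtain ⟨e, rfl⟩ : ∃ e, k = e + 1 := ⟨k - 1, by omega⟩
  have h := hv.cross_lt (show 1 ≤ e by omega) (Nat.lt_succ_self e) (Nat.lt_succ_self (e + 1)) hks
  have h₁ : (m (e + 1) : ℝ) < m e := by
    exact_mod_cast hv.strictAnti ⟨by omega, by omega⟩ ⟨by omega, by omega⟩ (Nat.lt_succ_self e)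
  have h₂ : (m (e + 1 + 1) : ℝ) < m (e + 1) := by
    exact_mod_cast hv.strictAnti ⟨by omega, by omega⟩ ⟨by omega, by omega⟩
      (Nat.lt_succ_self (e + 1))
  simp only [weightTwo, weightOne, edgeWeight, Nat.add_sub_cancel, sub_pos]
  rw [div_lt_div_iff₀ (by linarith) (by linarith)]
  exact h

theorem IsVertices.edgeWeight_mul_intercept (hv : IsVertices b s n m) {j : ℕ} (h₁ : 1 ≤ j)
    (h₂ : j + 1 ≤ s) :
    edgeWeight n m j * intercept n m j = n j + edgeWeight n m j * m j := by
  have h3 : (n j : ℝ) < n (j + 1) := by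
    exact_mod_cast hv.strictMono ⟨h₁, by omega⟩ ⟨by omega, h₂⟩ (Nat.lt_succ_self j)
  have h4 : (m (j + 1) : ℝ) < m j := by
    exact_mod_cast hv.strictAnti ⟨h₁, by omega⟩ ⟨by omega, h₂⟩ (Nat.lt_succ_self j)
  have h5 : (n (j + 1) : ℝ) - n j ≠ 0 := by linarith
  have h6 : (m j : ℝ) - m (j + 1) ≠ 0 := by linarith
  simp only [edgeWeight, intercept]
  field_simp
  ring

/-- The line through the vertices `j` and `j + 1`, seen from the vertex `j + 1`. -/
theorem IsVertices.edgeWeight_mul_intercept_succ (hv : IsVertices b s n m) {j : ℕ} (h₁ : 1 ≤ j)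
    (h₂ : j + 1 ≤ s) :
    edgeWeight n m j * intercept n m j = n (j + 1) + edgeWeight n m j * m (j + 1) := by
  have h4 : (m (j + 1) : ℝ) < m j := by
    exact_mod_cast hv.strictAnti ⟨h₁, by omega⟩ ⟨by omega, h₂⟩ (Nat.lt_succ_self j)
  have h6 : (m j : ℝ) - m (j + 1) ≠ 0 := by linarith
  rw [hv.edgeWeight_mul_intercept h₁ h₂, edgeWeight]
  field_simp
  ring

/-- If the polygon lies above the line of slope `-1 / t` through `(0, D)`, then `(0, D)` is a
vertex as soon as it belongs to the support. -/
theorem IsVertices.eq_first_vertex (hv : IsVertices b s n m) {t : ℝ} (ht : 0 < t) {D : ℕ}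
    (h : ∀ i j : ℕ, b i j ≠ 0 → t * D ≤ i + t * j) (hb : b 0 D ≠ 0) : (n 1, m 1) = (0, D) := by
  have hN : newtonPolygon b ⊆ {v | 0 ≤ v.1} ∩ {v | t * D ≤ v.1 + t * v.2} := by
    refine convexHull_min ?_ ?_
    · rintro v ⟨i, j, hb', hi, hj⟩
      have h1 := h i j hb'
      have h2 : t * j ≤ t * v.2 := mul_le_mul_of_nonneg_left hj ht.le
      have h3 : (0 : ℝ) ≤ i := Nat.cast_nonneg i
      exact ⟨h3.trans hi, show t * D ≤ v.1 + t * v.2 by linarith⟩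
    · refine Convex.inter ?_ ?_
      · exact convex_halfSpace_ge (f := fun v : ℝ × ℝ => v.1) ⟨fun _ _ => rfl, fun _ _ => rfl⟩ 0
      · exact convex_halfSpace_ge (f := fun v : ℝ × ℝ => v.1 + t * v.2)
          ⟨fun u v => by simp; ring, fun c v => by simp; ring⟩ _
  have hext : ((0 : ℝ), (D : ℝ)) ∈ (newtonPolygon b).extremePoints ℝ := by
    rw [mem_extremePoints_iff_left]
    refine ⟨mem_newtonPolygon_of_ne hb (by simp) le_rfl, ?_⟩
    rintro v hv u hu ⟨x, y, hx, hy, hxy, he⟩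
    obtain ⟨hv₁, hv₂⟩ := hN hv
    obtain ⟨hu₁, hu₂⟩ := hN hu
    simp only [Set.mem_ofPred_eq] at hv₁ hv₂ hu₁ hu₂
    have e1 : x * v.1 + y * u.1 = 0 := by simpa using congrArg Prod.fst he
    have e2 : x * v.2 + y * u.2 = D := by simpa using congrArg Prod.snd he
    have h1 := mul_nonneg hx.le hv₁
    have h2 := mul_nonneg hy.le hu₁
    have hv0 : v.1 = 0 := (mul_eq_zero.1 (by linarith : x * v.1 = 0)).resolve_left hx.ne'
    have hu0 : u.1 = 0 := (mul_eq_zero.1 (by linarith : y * u.1 = 0)).resolve_left hy.ne'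
    rw [hv0, zero_add] at hv₂
    rw [hu0, zero_add] at hu₂
    have hv₃ := le_of_mul_le_mul_left hv₂ ht
    have hu₃ := le_of_mul_le_mul_left hu₂ ht
    have h3 := mul_nonneg hx.le (sub_nonneg.2 hv₃)
    have h4 := mul_nonneg hy.le (sub_nonneg.2 hu₃)
    have h5 : x * (v.2 - D) + y * (u.2 - D) = 0 := by
      have : x * (v.2 - D) + y * (u.2 - D) = (x * v.2 + y * u.2) - (x + y) * D := by ring
      rw [this, e2, hxy]; ring
    have h6 : v.2 - D = 0 :=
      (mul_eq_zero.1 (by linarith : x * (v.2 - D) = 0)).resolve_left hx.ne'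
    exact Prod.ext hv0 (by simp only; linarith)
  rw [hv.vertices] at hext
  obtain ⟨l, ⟨hl1, hl2⟩, hl⟩ := hext
  simp only [Prod.mk.injEq, Nat.cast_eq_zero, Nat.cast_inj] at hl
  rcases hl1.eq_or_lt with rfl | hl1
  · exact Prod.ext hl.1 hl.2
  · have := hv.strictMono ⟨le_rfl, by omega⟩ ⟨hl1.le, hl2⟩ hl1
    omega

end NewtonPolygon

/-! ### Real sequences with geometric growth -/

section Recursions

/-- A sequence with `u (n + 1) = D u n + O(1)`, `D > 1`, grows like a multiple of `D ^ n`. -/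
theorem exists_tendsto_div_pow {u : ℕ → ℝ} {D C : ℝ} (hD : 1 < D)
    (h : ∀ᶠ n in atTop, |u (n + 1) - D * u n| ≤ C) :
    ∃ g : ℝ, Tendsto (fun n => u n / D ^ n) atTop (𝓝 g) := by
  obtain ⟨N, hN⟩ := eventually_atTop.1 h
  have hD0 : 0 < D := by linarith
  have hc : CauchySeq (fun n => u (n + N) / D ^ (n + N)) := by
    refine cauchySeq_of_le_geometric D⁻¹ (C / D ^ (N + 1)) (inv_lt_one_of_one_lt₀ hD) (fun n => ?_)
    have h1 := hN (n + N) (Nat.le_add_left _ _)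
    rw [dist_comm, Real.dist_eq]
    have e : u (n + 1 + N) / D ^ (n + 1 + N) - u (n + N) / D ^ (n + N)
        = (u (n + N + 1) - D * u (n + N)) / D ^ (n + N + 1) := by
      rw [show n + 1 + N = n + N + 1 by ring]
      field_simp
      ring
    rw [e, abs_div, abs_of_pos (pow_pos hD0 (n + N + 1))]
    have e' : C / D ^ (N + 1) * D⁻¹ ^ n = C / D ^ (n + N + 1) := by
      rw [inv_pow, show n + N + 1 = n + (N + 1) by ring, pow_add D n]
      field_simp
    rw [e']
    gcongr
  obtain ⟨g, hg⟩ := cauchySeq_tendsto_of_complete hc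
  exact ⟨g, (tendsto_add_atTop_iff_nat N).1 hg⟩

/-- A sequence with `v (n + 1) = d v n + O(1)`, `1 ≤ d < D`, is negligible compared to `D ^ n`. -/
theorem tendsto_div_pow_zero {v : ℕ → ℝ} {d D C : ℝ} (hd : 1 ≤ d) (hD : d < D)
    (h : ∀ᶠ n in atTop, |v (n + 1) - d * v n| ≤ C) :
    Tendsto (fun n => v n / D ^ n) atTop (𝓝 0) := by
  obtain ⟨N, hN⟩ := eventually_atTop.1 h
  have hd0 : 0 < d := by linarith
  have hD0 : 0 < D := by linarith
  have hC : 0 ≤ C := (abs_nonneg _).trans (hN N le_rfl)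
  have hb : ∀ n : ℕ, |v (n + N)| ≤ d ^ n * (|v N| + n * C) := by
    intro n
    induction n with
    | zero => simp
    | succ n ih =>
      have h1 := hN (n + N) (Nat.le_add_left _ _)
      have h2 : |v (n + N + 1)| ≤ |v (n + N + 1) - d * v (n + N)| + d * |v (n + N)| := by
        calc |v (n + N + 1)| = |(v (n + N + 1) - d * v (n + N)) + d * v (n + N)| := by ring_nf
          _ ≤ _ := abs_add_le _ _
          _ = _ := by rw [abs_mul, abs_of_pos hd0]
      have h3 : d * |v (n + N)| ≤ d * (d ^ n * (|v N| + n * C)) :=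
        mul_le_mul_of_nonneg_left ih hd0.le
      have h4 : C ≤ d ^ (n + 1) * C := le_mul_of_one_le_left hC (one_le_pow₀ hd)
      rw [show n + 1 + N = n + N + 1 by ring]
      calc |v (n + N + 1)| ≤ C + d * (d ^ n * (|v N| + n * C)) := by linarith
        _ ≤ d ^ (n + 1) * C + d * (d ^ n * (|v N| + n * C)) := by linarith
        _ = d ^ (n + 1) * (|v N| + ((n + 1 : ℕ) : ℝ) * C) := by push_cast; ring
  have hr0 : 0 ≤ d / D := by positivity
  have hr1 : d / D < 1 := (div_lt_one hD0).2 hD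
  have hlim : Tendsto (fun n : ℕ => (|v N| * (d / D) ^ n + C * (n * (d / D) ^ n)) / D ^ N) atTop
      (𝓝 ((|v N| * 0 + C * 0) / D ^ N)) :=
    (((tendsto_pow_atTop_nhds_zero_of_lt_one hr0 hr1).const_mul _).add
      ((tendsto_self_mul_const_pow_of_lt_one hr0 hr1).const_mul _)).div_const _
  rw [show (|v N| * 0 + C * 0) / D ^ N = 0 by simp] at hlim
  refine (tendsto_add_atTop_iff_nat N).1 (squeeze_zero_norm (fun n => ?_) hlim)
  rw [Real.norm_eq_abs, abs_div, abs_of_pos (pow_pos hD0 (n + N)), pow_add]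
  calc |v (n + N)| / (D ^ n * D ^ N) ≤ d ^ n * (|v N| + n * C) / (D ^ n * D ^ N) := by
        gcongr; exact hb n
    _ = _ := by rw [div_pow]; field_simp

/-- If `M` is at most `Z`, where `Z` grows like `D ^ n`, and `M` grows faster as long as it
is less than `Z`, then `M` reaches `Z` and stays there. -/
theorem eventually_eq_of_growth {M Z : ℕ → ℝ} {D κ C : ℝ} (hD : 1 < D) (hκ : 1 < κ)
    (hle : ∀ n, M n ≤ Z n) (hM : Tendsto M atTop atTop)
    (hMs : ∀ᶠ n in atTop, min (D * κ * M n - C) (Z (n + 1)) ≤ M (n + 1))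
    (hZs : ∀ᶠ n in atTop, |Z (n + 1) - D * Z n| ≤ C) :
    ∀ᶠ n in atTop, M n = Z n := by
  obtain ⟨κ', h1κ, hκ'⟩ := exists_between hκ
  have hD0 : 0 < D := by linarith
  have hbig : ∀ᶠ n in atTop, C ≤ D * (κ - κ') * M n ∧ C ≤ D * (κ' - 1) * M n ∧ 1 ≤ M n := by
    have h1 : 0 < D * (κ - κ') := mul_pos hD0 (by linarith)
    have h2 : 0 < D * (κ' - 1) := mul_pos hD0 (by linarith)
    exact ((hM.const_mul_atTop h1).eventually_ge_atTop C).and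
      (((hM.const_mul_atTop h2).eventually_ge_atTop C).and (hM.eventually_ge_atTop 1))
  obtain ⟨N, hN⟩ := eventually_atTop.1 (hbig.and (hMs.and hZs))
  have step : ∀ n ≥ N, min (D * κ' * M n) (Z (n + 1)) ≤ M (n + 1) := by
    intro n hn
    obtain ⟨⟨h1, h2, h3⟩, h4, h5⟩ := hN n hn
    exact (min_le_min (by linarith) le_rfl).trans h4
  have stay : ∀ n ≥ N, M n = Z n → M (n + 1) = Z (n + 1) := by
    intro n hn h
    obtain ⟨⟨h1, h2, h3⟩, h4, h5⟩ := hN n hn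
    have h6 := step n hn
    rw [min_eq_right] at h6
    · exact le_antisymm (hle _) h6
    · have := (abs_le.1 h5).2
      rw [← h] at this
      linarith
  have reach : ∃ n ≥ N, M n = Z n := by
    by_contra! hcon
    have grow : ∀ n : ℕ, (D * κ') ^ n ≤ M (n + N) := by
      intro n
      induction n with
      | zero => simpa using (hN N le_rfl).1.2.2
      | succ n ih =>
        have h6 := step (n + N) (Nat.le_add_left _ _)
        have h7 : M (n + N + 1) < Z (n + N + 1) :=
          lt_of_le_of_ne (hle _) (hcon _ (by omega))
        rcases min_le_iff.1 h6 with h6 | h6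
        · rw [show n + 1 + N = n + N + 1 by ring, pow_succ']
          exact (mul_le_mul_of_nonneg_left ih (by positivity)).trans h6
        · linarith
    obtain ⟨g, hg⟩ := exists_tendsto_div_pow hD hZs
    have h1 : Tendsto (fun n => Z (n + N) / D ^ (n + N)) atTop (𝓝 g) :=
      hg.comp (tendsto_add_atTop_nat N)
    have h2 : Tendsto (fun n : ℕ => κ' ^ n / D ^ N) atTop atTop :=
      (tendsto_pow_atTop_atTop_of_one_lt h1κ).atTop_div_const (by positivity)
    have h3 : ∀ n : ℕ, κ' ^ n / D ^ N ≤ Z (n + N) / D ^ (n + N) := by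
      intro n
      have h4 := (grow n).trans (hle _)
      calc κ' ^ n / D ^ N = (D * κ') ^ n / D ^ (n + N) := by
            rw [mul_pow, pow_add]; field_simp
        _ ≤ _ := by gcongr
    exact not_tendsto_nhds_of_tendsto_atTop (tendsto_atTop_mono h3 h2) g h1
  obtain ⟨n₀, hn₀, h₀⟩ := reach
  refine eventually_atTop.2 ⟨n₀, fun n hn => ?_⟩
  induction n, hn using Nat.le_induction with
  | base => exact h₀
  | succ n hn ih => exact stay n (by omega) ih

end Recursions

/-! ### Local estimates for the two series -/

section LocalBounds

/-- Absolute convergence at `(ρ, ρ)` bounds the series, with one monomial removed,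
by any common bound of the remaining monomials in the rescaled variables. -/
theorem exists_norm_sub_monomial_le {b : ℕ → ℕ → ℂ} {q : ℂ × ℂ → ℂ}
    (h : ∀ᶠ x : ℂ × ℂ in 𝓝 0,
      HasSum (fun ij : ℕ × ℕ => b ij.1 ij.2 * x.1 ^ ij.1 * x.2 ^ ij.2) (q x)) :
    ∃ ρ B : ℝ, 0 < ρ ∧ ρ < 1 ∧ 0 < B ∧ ∀ x : ℂ × ℂ, ‖x.1‖ < ρ → ‖x.2‖ < ρ →
      ∀ (e : ℕ × ℕ) (E : ℝ), 0 ≤ E →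
        (∀ i j : ℕ, b i j ≠ 0 → (i, j) ≠ e → (‖x.1‖ / ρ) ^ i * (‖x.2‖ / ρ) ^ j ≤ E) →
        ‖q x - b e.1 e.2 * x.1 ^ e.1 * x.2 ^ e.2‖ ≤ B * E := by
  classical
  obtain ⟨ε, hε, h⟩ := Metric.eventually_nhds_iff.1 h
  set ρ : ℝ := min (ε / 2) (1 / 2) with hρ
  have hρ0 : 0 < ρ := by positivity
  have hρε : ρ < ε := (min_le_left _ _).trans_lt (by linarith)
  have hρ1 : ρ < 1 := (min_le_right _ _).trans_lt (by norm_num)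
  have hnρ : ‖(ρ : ℂ)‖ = ρ := by rw [Complex.norm_real, Real.norm_of_nonneg hρ0.le]
  have hmem : ∀ x : ℂ × ℂ, ‖x.1‖ ≤ ρ → ‖x.2‖ ≤ ρ → dist x 0 < ε := by
    intro x h1 h2
    rw [dist_zero_right, Prod.norm_def]
    exact (max_le h1 h2).trans_lt hρε
  have hS := (h (hmem ((ρ : ℂ), (ρ : ℂ)) hnρ.le hnρ.le)).summable.norm
  set S : ℝ := ∑' ij : ℕ × ℕ, ‖b ij.1 ij.2 * (ρ : ℂ) ^ ij.1 * (ρ : ℂ) ^ ij.2‖ with hSdef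
  have hS0 : 0 ≤ S := tsum_nonneg fun _ => norm_nonneg _
  refine ⟨ρ, S + 1, hρ0, hρ1, by linarith, fun x h1 h2 e E hE hbd => ?_⟩
  have hx := (h (hmem x h1.le h2.le)).update e 0
  have hle := hx.norm_le_of_bounded (hS.hasSum.mul_right E) (fun ij => ?_)
  · rw [show (0 : ℂ) - b e.1 e.2 * x.1 ^ e.1 * x.2 ^ e.2 + q x
      = q x - b e.1 e.2 * x.1 ^ e.1 * x.2 ^ e.2 by ring] at hle
    refine hle.trans ?_
    rw [← hSdef]
    nlinarith
  · by_cases hij : ij = e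
    · subst hij
      rw [Function.update_self, norm_zero]
      positivity
    · rw [Function.update_of_ne hij]
      by_cases hb : b ij.1 ij.2 = 0
      · simp [hb]
      · have := hbd ij.1 ij.2 hb hij
        simp only [norm_mul, norm_pow, hnρ]
        calc ‖b ij.1 ij.2‖ * ‖x.1‖ ^ ij.1 * ‖x.2‖ ^ ij.2
            = ‖b ij.1 ij.2‖ * ρ ^ ij.1 * ρ ^ ij.2 *
              ((‖x.1‖ / ρ) ^ ij.1 * (‖x.2‖ / ρ) ^ ij.2) := by
              rw [div_pow, div_pow]; field_simp
          _ ≤ _ := by gcongr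

theorem abs_log_norm_sub_le {u v : ℂ} (hv : v ≠ 0) (h : ‖u - v‖ ≤ ‖v‖ / 2) :
    u ≠ 0 ∧ |Real.log ‖u‖ - Real.log ‖v‖| ≤ Real.log 2 := by
  have hv0 : 0 < ‖v‖ := norm_pos_iff.2 hv
  have h1 : ‖v‖ / 2 ≤ ‖u‖ := by
    have := norm_sub_norm_le v u
    rw [norm_sub_rev] at this
    linarith
  have h2 : ‖u‖ ≤ 2 * ‖v‖ := by
    have := norm_sub_norm_le u v
    linarith
  have hu0 : 0 < ‖u‖ := by linarith
  refine ⟨norm_pos_iff.1 hu0, abs_le.2 ⟨?_, ?_⟩⟩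
  · have := Real.log_le_log (by positivity) h1
    rw [Real.log_div hv0.ne' two_ne_zero] at this
    linarith
  · have := Real.log_le_log hu0 h2
    rw [Real.log_mul two_ne_zero hv0.ne'] at this
    linarith

/-- Near the origin `log |p z| = δ log |z| + O(1)`. -/
theorem exists_abs_log_sub_le {p : ℂ → ℂ} {a : ℂ} {δ : ℕ} (ha : a ≠ 0)
    (h : (fun z : ℂ => p z - a * z ^ δ) =O[𝓝 0] (fun z : ℂ => z ^ (δ + 1))) :
    ∃ ε C : ℝ, 0 < ε ∧ ∀ z : ℂ, z ≠ 0 → ‖z‖ < ε →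
      p z ≠ 0 ∧ |Real.log ‖p z‖ - δ * Real.log ‖z‖| ≤ C := by
  obtain ⟨K, hK, h⟩ := h.exists_pos
  obtain ⟨ε, hε, h⟩ := Metric.eventually_nhds_iff.1 h.bound
  have ha0 : 0 < ‖a‖ := norm_pos_iff.2 ha
  refine ⟨min ε (‖a‖ / (2 * K)), Real.log 2 + |Real.log ‖a‖|, by positivity, fun z hz hzε => ?_⟩
  have hz0 : 0 < ‖z‖ := norm_pos_iff.2 hz
  have h1 := h (by rw [dist_zero_right]; exact hzε.trans_le (min_le_left _ _) : dist z 0 < ε)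
  have h2 : ‖z‖ * (2 * K) < ‖a‖ :=
    (lt_div_iff₀ (by positivity)).1 (hzε.trans_le (min_le_right _ _))
  have h3 : ‖p z - a * z ^ δ‖ ≤ ‖a * z ^ δ‖ / 2 := by
    refine h1.trans ?_
    rw [norm_mul, norm_pow, norm_pow, pow_succ]
    have := mul_le_mul_of_nonneg_right h2.le (pow_nonneg hz0.le δ)
    linarith
  obtain ⟨h4, h5⟩ := abs_log_norm_sub_le (mul_ne_zero ha (pow_ne_zero _ hz)) h3
  refine ⟨h4, ?_⟩
  rw [norm_mul, norm_pow, Real.log_mul ha0.ne' (by positivity), Real.log_pow] at h5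
  have h6 := abs_le.1 h5
  have h7 := abs_le.1 (le_refl |Real.log ‖a‖|)
  exact abs_le.2 ⟨by linarith, by linarith⟩

/-- In logarithmic coordinates `X = -log |z|`, `Y = -log |w|`, the monomial `(γ, d)` dominates
the monomial `(i, j)` by a factor `exp L` deep inside the wedge. -/
theorem add_le_of_mem_wedge {γ d i j : ℕ} {l₁ l X Y L : ℝ} (hL : 0 ≤ L) (hne : (i, j) ≠ (γ, d))
    (h₁ : (γ : ℝ) + l₁ * d ≤ i + l₁ * j) (h₂ : (γ : ℝ) + l * d ≤ i + l * j) (hX : L ≤ X)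
    (hY : L + l₁ * X ≤ Y) (hY' : L + Y ≤ l * X) : γ * X + d * Y + L ≤ i * X + j * Y := by
  rcases lt_trichotomy j d with hj | rfl | hj
  · have hj' : (j : ℝ) + 1 ≤ d := by exact_mod_cast hj
    have e1 := mul_nonneg (by linarith : (0 : ℝ) ≤ d - j) (by linarith : 0 ≤ l * X - L - Y)
    have e2 := mul_nonneg (by linarith : (0 : ℝ) ≤ d - j - 1) hL
    have e3 := mul_nonneg (by linarith : (0 : ℝ) ≤ i + l * j - (γ + l * d))
      (by linarith : 0 ≤ X)
    nlinarith
  · have hi : γ + 1 ≤ i := by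
      have h3 : γ ≤ i := by exact_mod_cast (by linarith : (γ : ℝ) ≤ i)
      have h4 : i ≠ γ := fun h => hne (by rw [h])
      omega
    have hi' : (γ : ℝ) + 1 ≤ i := by exact_mod_cast hi
    have e1 := mul_nonneg (by linarith : (0 : ℝ) ≤ i - γ - 1) (by linarith : 0 ≤ X)
    nlinarith
  · have hj' : (d : ℝ) + 1 ≤ j := by exact_mod_cast hj
    have e1 := mul_nonneg (by linarith : (0 : ℝ) ≤ j - d) (by linarith : 0 ≤ Y - L - l₁ * X)
    have e2 := mul_nonneg (by linarith : (0 : ℝ) ≤ j - d - 1) hL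
    have e3 := mul_nonneg (by linarith : (0 : ℝ) ≤ i + l₁ * j - (γ + l₁ * d))
      (by linarith : 0 ≤ X)
    nlinarith

/-- On the logarithmic wedge the series equals its dominant monomial up to a bounded factor. -/
theorem exists_abs_log_sub_monomial_le {b : ℕ → ℕ → ℂ} {q : ℂ × ℂ → ℂ}
    (h : ∀ᶠ x : ℂ × ℂ in 𝓝 0,
      HasSum (fun ij : ℕ × ℕ => b ij.1 ij.2 * x.1 ^ ij.1 * x.2 ^ ij.2) (q x))
    {γ d : ℕ} (hb : b γ d ≠ 0) {l₁ l : ℝ}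
    (h₁ : ∀ i j : ℕ, b i j ≠ 0 → (γ : ℝ) + l₁ * d ≤ i + l₁ * j)
    (h₂ : ∀ i j : ℕ, b i j ≠ 0 → (γ : ℝ) + l * d ≤ i + l * j) :
    ∃ L C : ℝ, ∀ x : ℂ × ℂ, x.1 ≠ 0 → x.2 ≠ 0 → L ≤ -Real.log ‖x.1‖ → L ≤ -Real.log ‖x.2‖ →
      L + l₁ * (-Real.log ‖x.1‖) ≤ -Real.log ‖x.2‖ →
      L + -Real.log ‖x.2‖ ≤ l * (-Real.log ‖x.1‖) →
      q x ≠ 0 ∧ |Real.log ‖q x‖ - (γ * Real.log ‖x.1‖ + d * Real.log ‖x.2‖)| ≤ C := by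
  obtain ⟨ρ, B, hρ, hρ1, hB, hq⟩ := exists_norm_sub_monomial_le h
  have hb0 : 0 < ‖b γ d‖ := norm_pos_iff.2 hb
  set P : ℝ := ρ ^ γ * ρ ^ d with hP
  have hP0 : 0 < P := by positivity
  set t : ℝ := Real.log ρ with ht
  have ht0 : t < 0 := Real.log_neg hρ hρ1
  -- `exp (-L') * B / (ρ ^ γ * ρ ^ d) ≤ ‖b γ d‖ / 2`
  set L' : ℝ := max 0 (Real.log (2 * B / (P * ‖b γ d‖))) with hL'
  have hL'0 : 0 ≤ L' := le_max_left _ _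
  have hexp : B * Real.exp (-L') ≤ P * ‖b γ d‖ / 2 := by
    have h3 : 2 * B / (P * ‖b γ d‖) ≤ Real.exp L' := by
      rw [← Real.log_le_iff_le_exp (by positivity)]
      exact le_max_right _ _
    rw [div_le_iff₀ (by positivity)] at h3
    rw [Real.exp_neg, ← div_eq_mul_inv, div_le_iff₀ (Real.exp_pos _)]
    linarith
  refine ⟨L' + 1 - t + |l₁ * t| + |l * t|, Real.log 2 + |Real.log ‖b γ d‖|,
    fun x hx hy hX hY hXY hYX => ?_⟩
  have a1 := abs_le.1 (le_refl |l₁ * t|)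
  have a2 := abs_le.1 (le_refl |l * t|)
  have hx0 : 0 < ‖x.1‖ := norm_pos_iff.2 hx
  have hy0 : 0 < ‖x.2‖ := norm_pos_iff.2 hy
  have hxρ : ‖x.1‖ < ρ := (Real.log_lt_log_iff hx0 hρ).1 (by linarith [abs_nonneg (l₁ * t)])
  have hyρ : ‖x.2‖ < ρ := (Real.log_lt_log_iff hy0 hρ).1 (by linarith [abs_nonneg (l₁ * t)])
  have lx : Real.log (‖x.1‖ / ρ) = Real.log ‖x.1‖ - t := Real.log_div hx0.ne' hρ.ne'
  have ly : Real.log (‖x.2‖ / ρ) = Real.log ‖x.2‖ - t := Real.log_div hy0.ne' hρ.ne'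
  have hmono : ∀ i j : ℕ, (‖x.1‖ / ρ) ^ i * (‖x.2‖ / ρ) ^ j
      = Real.exp (-(i * (-(Real.log ‖x.1‖ - t)) + j * (-(Real.log ‖x.2‖ - t)))) := by
    intro i j
    rw [← Real.exp_log (show 0 < (‖x.1‖ / ρ) ^ i * (‖x.2‖ / ρ) ^ j by positivity),
      Real.log_mul (by positivity) (by positivity), Real.log_pow, Real.log_pow, lx, ly]
    ring_nf
  have key := hq x hxρ hyρ (γ, d) (Real.exp (-L') * ((‖x.1‖ / ρ) ^ γ * (‖x.2‖ / ρ) ^ d))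
    (by positivity) (fun i j hij hne => by
      rw [hmono i j, hmono γ d, ← Real.exp_add, Real.exp_le_exp]
      have := add_le_of_mem_wedge (X := -(Real.log ‖x.1‖ - t)) (Y := -(Real.log ‖x.2‖ - t))
        hL'0 hne (h₁ i j hij) (h₂ i j hij) (by linarith [abs_nonneg (l₁ * t)])
        (by linarith) (by linarith)
      linarith)
  have hsmall : ‖q x - b γ d * x.1 ^ γ * x.2 ^ d‖ ≤ ‖b γ d * x.1 ^ γ * x.2 ^ d‖ / 2 := by
    refine key.trans ?_
    calc B * (Real.exp (-L') * ((‖x.1‖ / ρ) ^ γ * (‖x.2‖ / ρ) ^ d))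
        = B * Real.exp (-L') * ((‖x.1‖ / ρ) ^ γ * (‖x.2‖ / ρ) ^ d) := by ring
      _ ≤ P * ‖b γ d‖ / 2 * ((‖x.1‖ / ρ) ^ γ * (‖x.2‖ / ρ) ^ d) := by gcongr
      _ = _ := by
        rw [norm_mul, norm_mul, norm_pow, norm_pow, hP, div_pow, div_pow]
        field_simp
  obtain ⟨h4, h5⟩ := abs_log_norm_sub_le
    (mul_ne_zero (mul_ne_zero hb (pow_ne_zero _ hx)) (pow_ne_zero _ hy)) hsmall
  refine ⟨h4, ?_⟩
  rw [norm_mul, norm_mul, norm_pow, norm_pow, Real.log_mul (by positivity) (by positivity),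
    Real.log_mul hb0.ne' (by positivity), Real.log_pow, Real.log_pow] at h5
  have h6 := abs_le.1 h5
  have h7 := abs_le.1 (le_refl |Real.log ‖b γ d‖|)
  exact abs_le.2 ⟨by linarith, by linarith⟩

end LocalBounds

/-! ### Extended logarithms -/

section Logarithm

theorem elog_of_pos {t : ℝ} (ht : 0 < t) : elog t = (Real.log t : EReal) := by
  rw [elog, ENNReal.log_ofReal, if_neg (not_le.2 ht)]

theorem elog_of_nonpos {t : ℝ} (ht : t ≤ 0) : elog t = ⊥ := by
  rw [elog, ENNReal.log_ofReal, if_pos ht]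

theorem tendsto_mul_elog {t : ℕ → ℝ} {D g : ℝ} (ht : ∀ᶠ n in atTop, 0 < t n)
    (h : Tendsto (fun n => Real.log (t n) / D ^ n) atTop (𝓝 g)) :
    Tendsto (fun n => (((D ^ n)⁻¹ : ℝ) : EReal) * elog (t n)) atTop (𝓝 (g : EReal)) := by
  refine (EReal.tendsto_coe.2 h).congr' ?_
  filter_upwards [ht] with n hn
  rw [elog_of_pos hn, ← EReal.coe_mul, div_eq_inv_mul]

theorem mul_elog_le {c t u : ℝ} (hc : 0 < c) (h : t ≤ Real.exp u) :
    (c : EReal) * elog t ≤ ((c * u : ℝ) : EReal) := by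
  rcases le_or_gt t 0 with ht | ht
  · rw [elog_of_nonpos ht, EReal.coe_mul_bot_of_pos hc]
    exact bot_le
  · rw [elog_of_pos ht, ← EReal.coe_mul, EReal.coe_le_coe_iff]
    exact mul_le_mul_of_nonneg_left ((Real.log_le_iff_le_exp ht).2 h) hc.le

end Logarithm

/-! ### The limit `G_p` -/

section Green

variable {D : Set ℂ} {p : ℂ → ℂ} {q : ℂ × ℂ → ℂ} {a : ℂ} {δ : ℕ} {b : ℕ → ℕ → ℂ}

theorem skew_iterate_fst (x : ℂ × ℂ) (N : ℕ) : ((skew p q)^[N] x).1 = p^[N] x.1 := by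
  induction N with
  | zero => rfl
  | succ N ih => rw [Function.iterate_succ_apply', Function.iterate_succ_apply', ← ih]; rfl

theorem skew_iterate_succ_snd (x : ℂ × ℂ) (N : ℕ) :
    ((skew p q)^[N + 1] x).2 = q ((skew p q)^[N] x) := by
  rw [Function.iterate_succ_apply']; rfl

theorem IsSuperattracting.map_zero (hf : IsSuperattracting D p q a δ b) : p 0 = 0 := by
  obtain ⟨K, h⟩ := hf.expand_p.bound
  have h0 := h.self_of_nhds
  have hδ : δ ≠ 0 := by have := hf.two_le; omega
  simpa [hδ] using h0

theorem IsSuperattracting.iterate_eq_zero (hf : IsSuperattracting D p q a δ b) {z : ℂ} {N n : ℕ}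
    (hN : p^[N] z = 0) (hn : N ≤ n) : p^[n] z = 0 := by
  induction n, hn using Nat.le_induction with
  | base => exact hN
  | succ n _ ih => rw [Function.iterate_succ_apply', ih, hf.map_zero]

/-- On an orbit of `p` which tends to `0` without reaching it, `G_p` is finite. -/
theorem IsSuperattracting.tendsto_seqP_of_ne (hf : IsSuperattracting D p q a δ b) {z : ℂ}
    (hz : Tendsto (fun n : ℕ => p^[n] z) atTop (𝓝 0)) (hne : ∀ n, p^[n] z ≠ 0) :
    ∃ g C : ℝ, (∀ᶠ n : ℕ in atTop,
        |Real.log ‖p^[n + 1] z‖ - δ * Real.log ‖p^[n] z‖| ≤ C) ∧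
      Tendsto (fun n : ℕ => Real.log ‖p^[n] z‖ / (δ : ℝ) ^ n) atTop (𝓝 g) ∧
      Tendsto (seqP p δ z) atTop (𝓝 (g : EReal)) ∧ greenP p δ z = g := by
  obtain ⟨ε, C, hε, hC⟩ := exists_abs_log_sub_le hf.lead_ne hf.expand_p
  have hδ : (1 : ℝ) < δ := by exact_mod_cast hf.two_le
  have h : ∀ᶠ n : ℕ in atTop, |Real.log ‖p^[n + 1] z‖ - δ * Real.log ‖p^[n] z‖| ≤ C := by
    have : Tendsto (fun n : ℕ => ‖p^[n] z‖) atTop (𝓝 0) := by simpa using hz.norm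
    filter_upwards [this.eventually (gt_mem_nhds hε)] with n hn
    rw [Function.iterate_succ_apply']
    exact (hC _ (hne n) hn).2
  obtain ⟨g, hg⟩ :=
    exists_tendsto_div_pow (u := fun n : ℕ => Real.log ‖p^[n] z‖) hδ h
  have hs : Tendsto (seqP p δ z) atTop (𝓝 (g : EReal)) :=
    tendsto_mul_elog (Eventually.of_forall fun n => norm_pos_iff.2 (hne n)) hg
  exact ⟨g, C, h, hg, hs, hs.limUnder_eq⟩

theorem IsSuperattracting.tendsto_seqP_of_eq_zero (hf : IsSuperattracting D p q a δ b) {z : ℂ}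
    {N : ℕ} (hN : p^[N] z = 0) :
    Tendsto (seqP p δ z) atTop (𝓝 ⊥) ∧ greenP p δ z = ⊥ := by
  have hδ : (0 : ℝ) < δ := by exact_mod_cast (by have := hf.two_le; omega : 0 < δ)
  have hs : Tendsto (seqP p δ z) atTop (𝓝 ⊥) := by
    refine tendsto_const_nhds.congr' ?_
    filter_upwards [eventually_ge_atTop N] with n hn
    rw [seqP, hf.iterate_eq_zero hN hn, norm_zero, elog_of_nonpos le_rfl,
      EReal.coe_mul_bot_of_pos (by positivity)]
  exact ⟨hs, hs.limUnder_eq⟩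

theorem IsSuperattracting.tendsto_seqP (hf : IsSuperattracting D p q a δ b) {z : ℂ}
    (hz : z ∈ basinP D p) : Tendsto (seqP p δ z) atTop (𝓝 (greenP p δ z)) := by
  by_cases h : ∀ n, p^[n] z ≠ 0
  · obtain ⟨g, C, -, -, h1, h2⟩ := hf.tendsto_seqP_of_ne hz.2 h
    rwa [h2]
  · push Not at h
    obtain ⟨N, hN⟩ := h
    obtain ⟨h1, h2⟩ := hf.tendsto_seqP_of_eq_zero hN
    rwa [h2]

theorem IsSuperattracting.mem_nhds (hf : IsSuperattracting D p q a δ b) : D ∈ 𝓝 (0 : ℂ) := by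
  rcases hf.domain with rfl | ⟨R, hR, rfl, -⟩
  · exact univ_mem
  · exact Metric.ball_mem_nhds _ hR

end Green

/-! ### Dynamics on the wedge -/

section Wedge

variable {D : Set ℂ} {p : ℂ → ℂ} {q : ℂ × ℂ → ℂ} {a : ℂ} {δ : ℕ} {b : ℕ → ℕ → ℂ}

/-- The wedge in logarithmic coordinates. -/
theorem mem_wedge_iff {l₁ l₂ r : ℝ} (hl₁ : 0 < l₁) (hr : 0 < r) {x : ℂ × ℂ} :
    x ∈ wedge l₁ l₂ r ↔ x.1 ≠ 0 ∧ x.2 ≠ 0 ∧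
      l₂ * (-Real.log r) + -Real.log ‖x.2‖ < (l₁ + l₂) * (-Real.log ‖x.1‖) ∧
      -Real.log r + l₁ * (-Real.log ‖x.1‖) < -Real.log ‖x.2‖ := by
  have aux : x.1 ≠ 0 → x.2 ≠ 0 → (x ∈ wedge l₁ l₂ r ↔
      l₂ * (-Real.log r) + -Real.log ‖x.2‖ < (l₁ + l₂) * (-Real.log ‖x.1‖) ∧
      -Real.log r + l₁ * (-Real.log ‖x.1‖) < -Real.log ‖x.2‖) := by
    intro h1 h2
    have hx := norm_pos_iff.2 h1
    have hy := norm_pos_iff.2 h2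
    simp only [wedge, Set.mem_ofPred_eq]
    rw [← Real.log_lt_log_iff (by positivity) (by positivity),
      ← Real.log_lt_log_iff hy (by positivity),
      Real.log_mul (by positivity) hy.ne', Real.log_mul hr.ne' (by positivity),
      Real.log_rpow hx, Real.log_rpow hx, Real.log_rpow hr]
    constructor <;> rintro ⟨h3, h4⟩ <;> constructor <;> linarith
  constructor
  · intro h
    have h1 : x.1 ≠ 0 := by
      intro h0
      have h2 := h.2
      rw [h0, norm_zero, Real.zero_rpow hl₁.ne', mul_zero] at h2
      exact absurd h2 (not_lt.2 (norm_nonneg _))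
    have h2 : x.2 ≠ 0 := by
      intro h0
      have h2 := h.1
      rw [h0, norm_zero, mul_zero] at h2
      exact absurd h2 (not_lt.2 (by positivity))
    exact ⟨h1, h2, (aux h1 h2).1 h⟩
  · rintro ⟨h1, h2, h⟩
    exact (aux h1 h2).2 h

/-- The affine map `(X, Y) ↦ (δ X, γ X + d Y)` preserves the logarithmic wedge, up to bounded
errors absorbed by a large `L`. -/
theorem wedge_step {δ γ d l₁ l₂ C L X Y X' Y' : ℝ} (hl₁ : 0 < l₁) (hl₂ : 0 < l₂) (hd : 1 ≤ d)
    (he₁ : 0 ≤ γ + l₁ * d - l₁ * δ) (he₂ : 0 ≤ (l₁ + l₂) * δ - (γ + (l₁ + l₂) * d))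
    (hL₁ : C * (1 + l₁) < (γ + l₁ * d - l₁ * δ + (d - 1)) * L)
    (hL₂ : C * (1 + (l₁ + l₂)) < ((l₁ + l₂) * δ - (γ + (l₁ + l₂) * d) + l₂ * (d - 1)) * L)
    (hX : L ≤ X) (h₁ : l₂ * L + Y < (l₁ + l₂) * X) (h₂ : L + l₁ * X < Y)
    (hX' : |X' - δ * X| ≤ C) (hY' : |Y' - (γ * X + d * Y)| ≤ C) :
    l₂ * L + Y' < (l₁ + l₂) * X' ∧ L + l₁ * X' < Y' := by
  obtain ⟨hX'₁, hX'₂⟩ := abs_le.1 hX'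
  obtain ⟨hY'₁, hY'₂⟩ := abs_le.1 hY'
  constructor
  · have e1 := mul_le_mul_of_nonneg_left hX he₂
    have e2 : d * Y ≤ d * ((l₁ + l₂) * X - l₂ * L) :=
      mul_le_mul_of_nonneg_left (by linarith) (by linarith)
    have e3 : (l₁ + l₂) * (δ * X - C) ≤ (l₁ + l₂) * X' :=
      mul_le_mul_of_nonneg_left (by linarith) (by linarith)
    linarith
  · have e1 := mul_le_mul_of_nonneg_left hX he₁
    have e2 : d * (L + l₁ * X) ≤ d * Y :=
      mul_le_mul_of_nonneg_left (by linarith) (by linarith)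
    have e3 : l₁ * X' ≤ l₁ * (δ * X + C) :=
      mul_le_mul_of_nonneg_left (by linarith) (by linarith)
    linarith

/-- Small wedges at the vertex `(γ, d)` are mapped into themselves, with contraction in `z`,
and there `q` equals `b γ d * z ^ γ * w ^ d` up to a bounded factor. -/
theorem IsSuperattracting.exists_wedge_invariant (hf : IsSuperattracting D p q a δ b)
    {γ d : ℕ} {l₁ l₂ : ℝ} (hb : b γ d ≠ 0) (hd : 1 ≤ d) (hl₁ : 0 < l₁) (hl₂ : 0 < l₂)
    (h₁ : ∀ i j : ℕ, b i j ≠ 0 → (γ : ℝ) + l₁ * d ≤ i + l₁ * j)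
    (h₂ : ∀ i j : ℕ, b i j ≠ 0 → (γ : ℝ) + (l₁ + l₂) * d ≤ i + (l₁ + l₂) * j)
    (he₁ : l₁ * δ ≤ γ + l₁ * d) (he₂ : γ + (l₁ + l₂) * d ≤ (l₁ + l₂) * δ)
    (hstrict : 2 ≤ d ∨ l₁ * δ < γ + l₁ * d ∧ γ + (l₁ + l₂) * d < (l₁ + l₂) * δ) :
    ∃ r₀ C : ℝ, 0 < r₀ ∧ ∀ r : ℝ, 0 < r → r < r₀ → ∀ x ∈ wedge l₁ l₂ r,
      x.1 ≠ 0 ∧ x.2 ≠ 0 ∧ x.1 ∈ D ∧ ‖p x.1‖ ≤ ‖x.1‖ / 2 ∧ skew p q x ∈ wedge l₁ l₂ r ∧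
      |Real.log ‖p x.1‖ - δ * Real.log ‖x.1‖| ≤ C ∧
      |Real.log ‖q x‖ - (γ * Real.log ‖x.1‖ + d * Real.log ‖x.2‖)| ≤ C := by
  obtain ⟨ε, C₁, hε, hp⟩ := exists_abs_log_sub_le hf.lead_ne hf.expand_p
  obtain ⟨L₁, C₂, hq⟩ := exists_abs_log_sub_monomial_le hf.expand_q hb h₁ h₂
  obtain ⟨R, hR, hRD⟩ := Metric.mem_nhds_iff.1 hf.mem_nhds
  set C : ℝ := max C₁ C₂ with hC
  have hδ : (2 : ℝ) ≤ δ := by exact_mod_cast hf.two_le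
  have hd' : (1 : ℝ) ≤ d := by exact_mod_cast hd
  have hs₁ : 0 < γ + l₁ * d - l₁ * δ + ((d : ℝ) - 1) := by
    rcases hstrict with h | ⟨h, -⟩
    · have : (2 : ℝ) ≤ d := by exact_mod_cast h
      linarith
    · linarith
  have hs₂ : 0 < (l₁ + l₂) * δ - (γ + (l₁ + l₂) * d) + l₂ * ((d : ℝ) - 1) := by
    rcases hstrict with h | ⟨-, h⟩
    · have : (2 : ℝ) ≤ d := by exact_mod_cast h
      have := mul_pos hl₂ (by linarith : (0 : ℝ) < d - 1)
      linarith
    · have := mul_nonneg hl₂.le (by linarith : (0 : ℝ) ≤ d - 1)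
      linarith
  -- all the conditions on `r` say that `-log r` is large
  have hev : ∀ᶠ L : ℝ in atTop, 0 < L ∧ L₁ ≤ L ∧ L₁ ≤ l₂ * L ∧
      C * (1 + l₁) < (γ + l₁ * d - l₁ * δ + ((d : ℝ) - 1)) * L ∧
      C * (1 + (l₁ + l₂)) <
        ((l₁ + l₂) * δ - (γ + (l₁ + l₂) * d) + l₂ * ((d : ℝ) - 1)) * L ∧
      -Real.log ε < L ∧ -Real.log R < L ∧ C + Real.log 2 < L := by
    have hT : ∀ c : ℝ, 0 < c → Tendsto (fun L : ℝ => c * L) atTop atTop :=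
      fun c hc => tendsto_id.const_mul_atTop hc
    filter_upwards [eventually_gt_atTop 0, eventually_ge_atTop L₁,
      (hT _ hl₂).eventually_ge_atTop L₁, (hT _ hs₁).eventually_gt_atTop (C * (1 + l₁)),
      (hT _ hs₂).eventually_gt_atTop (C * (1 + (l₁ + l₂))), eventually_gt_atTop (-Real.log ε),
      eventually_gt_atTop (-Real.log R), eventually_gt_atTop (C + Real.log 2)]
      with L a1 a2 a3 a4 a5 a6 a7 a8
    exact ⟨a1, a2, a3, a4, a5, a6, a7, a8⟩
  obtain ⟨L₀, hL₀⟩ := eventually_atTop.1 hev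
  refine ⟨Real.exp (-L₀), C, Real.exp_pos _, fun r hr hr₀ x hx => ?_⟩
  obtain ⟨hx1, hx2, hw₁, hw₂⟩ := (mem_wedge_iff hl₁ hr).1 hx
  have hL : L₀ ≤ -Real.log r := by
    have := Real.log_lt_log hr hr₀
    rw [Real.log_exp] at this
    linarith
  obtain ⟨a1, a2, a3, a4, a5, a6, a7, a8⟩ := hL₀ _ hL
  set L : ℝ := -Real.log r with hLdef
  have hX0 := norm_pos_iff.2 hx1
  set X : ℝ := -Real.log ‖x.1‖ with hXdef
  have hX : L < X := by
    have : l₂ * L < l₂ * X := by linarith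
    exact lt_of_mul_lt_mul_left this hl₂.le
  have hlX : 0 < l₁ * X := mul_pos hl₁ (by linarith)
  have hXε : ‖x.1‖ < ε := (Real.log_lt_log_iff hX0 hε).1 (by linarith)
  have hXR : ‖x.1‖ < R := (Real.log_lt_log_iff hX0 hR).1 (by linarith)
  obtain ⟨hp0, hpC⟩ := hp x.1 hx1 hXε
  obtain ⟨hq0, hqC⟩ := hq x hx1 hx2 (by linarith) (by linarith) (by linarith) (by linarith)
  have hpC := hpC.trans (le_max_left C₁ C₂)
  have hqC := hqC.trans (le_max_right C₁ C₂)
  rw [← hC] at hpC hqC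
  refine ⟨hx1, hx2, hRD (by simpa using hXR), ?_, ?_, hpC, hqC⟩
  · rw [← Real.log_le_log_iff (norm_pos_iff.2 hp0) (by positivity),
      Real.log_div hX0.ne' two_ne_zero]
    have h3 := (abs_le.1 hpC).2
    have h4 : 2 * X ≤ δ * X := mul_le_mul_of_nonneg_right hδ (by linarith)
    linarith
  · rw [mem_wedge_iff hl₁ hr]
    refine ⟨hp0, hq0, ?_⟩
    refine wedge_step (δ := δ) (γ := γ) (d := d) (C := C) (X := X) (Y := -Real.log ‖x.2‖)
      hl₁ hl₂ hd' (by linarith) (by linarith) a4 a5 hX.le hw₁ hw₂ ?_ ?_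
    · refine le_of_eq_of_le ?_ hpC
      rw [← abs_neg, hXdef]
      simp only [skew]
      ring_nf
    · refine le_of_eq_of_le ?_ hqC
      rw [← abs_neg, hXdef]
      simp only [skew]
      ring_nf

/-- On the preimages of a small invariant wedge the difference `log |w| - α log |z|` is multiplied
by `d < δ` at each step, up to a bounded error, and so does not contribute to the limit. -/
theorem IsSuperattracting.tendsto_seqZ (hf : IsSuperattracting D p q a δ b)
    {γ d : ℕ} {l₁ l₂ : ℝ} (hb : b γ d ≠ 0) (hd : 1 ≤ d) (hdδ : d < δ) (hl₁ : 0 < l₁) (hl₂ : 0 < l₂)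
    (h₁ : ∀ i j : ℕ, b i j ≠ 0 → (γ : ℝ) + l₁ * d ≤ i + l₁ * j)
    (h₂ : ∀ i j : ℕ, b i j ≠ 0 → (γ : ℝ) + (l₁ + l₂) * d ≤ i + (l₁ + l₂) * j)
    (he₁ : l₁ * δ ≤ γ + l₁ * d) (he₂ : γ + (l₁ + l₂) * d ≤ (l₁ + l₂) * δ)
    (hstrict : 2 ≤ d ∨ l₁ * δ < γ + l₁ * d ∧ γ + (l₁ + l₂) * d < (l₁ + l₂) * δ) :
    ∃ r₀ : ℝ, 0 < r₀ ∧ ∀ r : ℝ, 0 < r → r < r₀ → ∀ x ∈ preimages D p q (wedge l₁ l₂ r),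
      x.1 ∈ basinP D p ∧
      Tendsto (seqZ p q δ d x) atTop (𝓝 ((alpha γ d δ : EReal) * greenP p δ x.1)) := by
  obtain ⟨r₀, C, hr₀, H⟩ := hf.exists_wedge_invariant hb hd hl₁ hl₂ h₁ h₂ he₁ he₂ hstrict
  refine ⟨r₀, hr₀, fun r hr hrr x ⟨N, hND, hNw⟩ => ?_⟩
  have hmem : ∀ n ≥ N, (skew p q)^[n] x ∈ wedge l₁ l₂ r := by
    intro n hn
    induction n, hn using Nat.le_induction with
    | base => exact hNw
    | succ n _ ih =>
      rw [Function.iterate_succ_apply']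
      exact (H r hr hrr _ ih).2.2.2.2.1
  have Hn := fun n (hn : N ≤ n) => H r hr hrr _ (hmem n hn)
  simp only [skew_iterate_fst, ← Function.iterate_succ_apply' p, ← skew_iterate_succ_snd] at Hn
  have hne : ∀ n, p^[n] x.1 ≠ 0 := by
    intro n h0
    exact (Hn _ (le_max_right n N)).1 (hf.iterate_eq_zero h0 (le_max_left n N))
  have hlim : Tendsto (fun n : ℕ => p^[n] x.1) atTop (𝓝 0) := by
    have hgeo : ∀ n : ℕ, ‖p^[n + N] x.1‖ ≤ ‖p^[N] x.1‖ * (1 / 2) ^ n := by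
      intro n
      induction n with
      | zero => simp
      | succ n ih =>
        have := (Hn (n + N) (Nat.le_add_left _ _)).2.2.2.1
        rw [show n + 1 + N = n + N + 1 by ring, pow_succ]
        linarith
    refine (tendsto_add_atTop_iff_nat N).1 (squeeze_zero_norm hgeo ?_)
    have := (tendsto_pow_atTop_nhds_zero_of_lt_one (r := (1 / 2 : ℝ)) (by norm_num)
      (by norm_num)).const_mul ‖p^[N] x.1‖
    simpa using this
  refine ⟨⟨fun n => ?_, hlim⟩, ?_⟩
  · rcases le_total n N with hn | hn
    · have := hND n hn
      rwa [skew_iterate_fst] at this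
    · exact (Hn n hn).2.2.1
  obtain ⟨g, C', -, hg, -, hgreen⟩ := hf.tendsto_seqP_of_ne hlim hne
  set α : ℝ := alpha γ d δ with hα
  have hdδ' : (d : ℝ) < δ := by exact_mod_cast hdδ
  have hαeq : (γ : ℝ) = α * (δ - d) := by
    rw [hα, alpha, div_mul_cancel₀ _ (by linarith)]
  have hv : Tendsto (fun n : ℕ => (Real.log ‖((skew p q)^[n] x).2‖ - α * Real.log ‖p^[n] x.1‖) /
      (δ : ℝ) ^ n) atTop (𝓝 0) := by
    refine tendsto_div_pow_zero (d := d) (C := C + |α| * C) (by exact_mod_cast hd) hdδ' ?_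
    filter_upwards [eventually_ge_atTop N] with n hn
    obtain ⟨-, -, -, -, -, h3, h4⟩ := Hn n hn
    have h5 : |α * (Real.log ‖p^[n + 1] x.1‖ - δ * Real.log ‖p^[n] x.1‖)| ≤ |α| * C := by
      rw [abs_mul]
      exact mul_le_mul_of_nonneg_left h3 (abs_nonneg _)
    refine le_trans (le_of_eq_of_le ?_ (abs_sub _ _)) (add_le_add h4 h5)
    rw [hαeq]
    ring_nf
  have hw : Tendsto (fun n : ℕ => Real.log ‖((skew p q)^[n] x).2‖ / (δ : ℝ) ^ n) atTop
      (𝓝 (α * g)) := by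
    have := hv.add (hg.const_mul α)
    rw [zero_add] at this
    refine this.congr fun n => ?_
    ring
  rw [hgreen, ← EReal.coe_mul]
  unfold seqZ
  rw [max_eq_left hdδ.le]
  refine tendsto_mul_elog ?_ hw
  filter_upwards [eventually_ge_atTop N] with n hn
  exact norm_pos_iff.2 (Hn n hn).2.1

end Wedge

/-! ### Dynamics on the basin of the origin -/

section Basin

variable {D : Set ℂ} {p : ℂ → ℂ} {q : ℂ × ℂ → ℂ} {a : ℂ} {δ : ℕ} {b : ℕ → ℕ → ℂ}

/-- For `β < α` the linear form `i + β j` is larger than `δ β` on the support, by a definite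
factor: `(0, δ)` is the only possible obstruction. -/
theorem exists_one_lt_mul_le {α β : ℝ} (hδ : 0 < δ) (hβ : 0 < β) (hβα : β < α)
    (h : ∀ i j : ℕ, b i j ≠ 0 → α * δ ≤ i + α * j) (h0 : b 0 δ = 0) :
    ∃ κ : ℝ, 1 < κ ∧ ∀ i j : ℕ, b i j ≠ 0 → δ * κ * β ≤ i + β * j := by
  have hα : 0 < α := hβ.trans hβα
  have hδ' : (0 : ℝ) < δ := by exact_mod_cast hδ
  set η : ℝ := min (1 - β / α) β with hη
  have hη0 : 0 < η := lt_min (by rw [sub_pos, div_lt_one hα]; exact hβα) hβ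
  refine ⟨1 + η / (δ * β), by linarith [div_pos hη0 (mul_pos hδ' hβ)], fun i j hb => ?_⟩
  have e : δ * (1 + η / (δ * β)) * β = δ * β + η := by field_simp
  rw [e]
  have hij := h i j hb
  rcases Nat.eq_zero_or_pos i with rfl | hi
  · have hj : δ ≤ j := by
      rw [Nat.cast_zero, zero_add] at hij
      exact_mod_cast le_of_mul_le_mul_left hij hα
    have hj' : δ + 1 ≤ j := by
      rcases hj.eq_or_lt with rfl | hj
      · exact absurd h0 hb
      · exact hj
    have hj'' : (δ : ℝ) + 1 ≤ j := by exact_mod_cast hj'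
    have h1 := mul_le_mul_of_nonneg_left hj'' hβ.le
    have h2 : η ≤ β := min_le_right _ _
    push_cast
    linarith
  · have hi' : (1 : ℝ) ≤ i := by exact_mod_cast hi
    have h1 : η ≤ 1 - β / α := min_le_left _ _
    have hβα' : 0 ≤ 1 - β / α := hη0.le.trans h1
    have h2 : 1 - β / α ≤ (1 - β / α) * i := le_mul_of_one_le_right hβα' hi'
    have h3 := mul_le_mul_of_nonneg_left hij (div_pos hβ hα).le
    have h4 : β / α * (α * δ) = δ * β := by field_simp
    have h5 : β / α * (i + α * j) = β / α * i + β * j := by field_simp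
    linarith

/-- Along an orbit in the basin which avoids `{z = 0}`, eventually `|w| ≤ |z| ^ β` up to a constant
factor, for each `β < α`. -/
theorem IsSuperattracting.eventually_log_le (hf : IsSuperattracting D p q a δ b) {β κ : ℝ}
    (hβ : 0 < β) (hκ : 1 < κ) (h : ∀ i j : ℕ, b i j ≠ 0 → δ * κ * β ≤ i + β * j) {x : ℂ × ℂ}
    (hx : Tendsto (fun n : ℕ => (skew p q)^[n] x) atTop (𝓝 0)) (hne : ∀ n, p^[n] x.1 ≠ 0) :
    ∃ K : ℝ, 0 < K ∧ ∀ᶠ n : ℕ in atTop,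
      ‖((skew p q)^[n] x).2‖ ≤ K * ‖p^[n] x.1‖ ^ β := by
  obtain ⟨ρ, B, hρ, hρ1, hB, hq⟩ := exists_norm_sub_monomial_le hf.expand_q
  have hδ : (1 : ℝ) < δ := by exact_mod_cast hf.two_le
  have hz : Tendsto (fun n : ℕ => p^[n] x.1) atTop (𝓝 0) := by
    have := (continuous_fst.tendsto (0 : ℂ × ℂ)).comp hx
    simpa [Function.comp_def, skew_iterate_fst] using this
  have hw : Tendsto (fun n : ℕ => ((skew p q)^[n] x).2) atTop (𝓝 0) := by
    have := (continuous_snd.tendsto (0 : ℂ × ℂ)).comp hx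
    simpa [Function.comp_def] using this
  set X : ℕ → ℝ := fun n => ‖p^[n] x.1‖ / ρ with hX
  set Y : ℕ → ℝ := fun n => ‖((skew p q)^[n] x).2‖ / ρ with hY
  have hX0 : ∀ n, 0 < X n := fun n => div_pos (norm_pos_iff.2 (hne n)) hρ
  have hY0 : ∀ n, 0 ≤ Y n := fun n => by positivity
  have hXlim : Tendsto X atTop (𝓝 0) := by simpa using hz.norm.div_const ρ
  have hYlim : Tendsto Y atTop (𝓝 0) := by simpa using hw.norm.div_const ρ
  set u : ℕ → ℝ := fun n => max (Y n) (X n ^ β) with hu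
  have hXβ : ∀ n, 0 < X n ^ β := fun n => Real.rpow_pos_of_pos (hX0 n) β
  have hu0 : ∀ n, 0 < u n := fun n => (hXβ n).trans_le (le_max_right _ _)
  have hulim : Tendsto u atTop (𝓝 0) := by
    have h1 : Tendsto (fun n => X n ^ β) atTop (𝓝 0) := by
      simpa [Real.zero_rpow hβ.ne'] using hXlim.rpow_const (p := β) (Or.inr hβ.le)
    simpa using hYlim.max h1
  obtain ⟨g, C, hC, -, -, -⟩ := hf.tendsto_seqP_of_ne hz hne
  set C' : ℝ := max (β * (C + |(δ - 1) * Real.log ρ|)) (Real.log (B / ρ)) with hC'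
  have hlogX : ∀ n, Real.log (X n) = Real.log ‖p^[n] x.1‖ - Real.log ρ := fun n =>
    Real.log_div (norm_pos_iff.2 (hne n)).ne' hρ.ne'
  have key := eventually_eq_of_growth (M := fun n => -Real.log (u n))
    (Z := fun n => -Real.log (X n ^ β)) (D := δ) (κ := κ) (C := C') hδ hκ
    (fun n => neg_le_neg (Real.log_le_log (hXβ n) (le_max_right _ _)))
    (by
      refine tendsto_neg_atBot_atTop.comp (Real.tendsto_log_nhdsGT_zero.comp ?_)
      exact tendsto_nhdsWithin_iff.2 ⟨hulim, Eventually.of_forall hu0⟩)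
    (by
      filter_upwards [hulim.eventually (gt_mem_nhds one_pos), hXlim.eventually (gt_mem_nhds one_pos),
        hYlim.eventually (gt_mem_nhds one_pos)] with n hn1 hn2 hn3
      have hle : Y (n + 1) ≤ B / ρ * u n ^ ((δ : ℝ) * κ) := by
        -- as `b 0 0 = 0`, removing the monomial `(0, 0)` does not change the series
        have h1 := hq ((skew p q)^[n] x)
          (by rw [skew_iterate_fst]; exact (div_lt_one hρ).1 hn2) ((div_lt_one hρ).1 hn3)
          (0, 0) (u n ^ ((δ : ℝ) * κ)) (Real.rpow_nonneg (hu0 n).le _) (fun i j hb _ => by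
            rw [skew_iterate_fst]
            change X n ^ i * Y n ^ j ≤ _
            have h2 : X n ^ i ≤ u n ^ ((i : ℝ) / β) := by
              calc X n ^ i = (X n ^ β) ^ ((i : ℝ) / β) := by
                    rw [← Real.rpow_mul (hX0 n).le, mul_div_cancel₀ _ hβ.ne', Real.rpow_natCast]
                _ ≤ _ := Real.rpow_le_rpow (hXβ n).le (le_max_right _ _) (by positivity)
            have h3 : Y n ^ j ≤ u n ^ (j : ℝ) := by
              rw [Real.rpow_natCast]
              exact pow_le_pow_left₀ (hY0 n) (le_max_left _ _) _
            calc X n ^ i * Y n ^ j ≤ u n ^ ((i : ℝ) / β) * u n ^ (j : ℝ) :=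
                  mul_le_mul h2 h3 (pow_nonneg (hY0 n) _) (Real.rpow_nonneg (hu0 n).le _)
              _ = u n ^ ((i : ℝ) / β + j) := (Real.rpow_add (hu0 n) _ _).symm
              _ ≤ _ := by
                refine Real.rpow_le_rpow_of_exponent_ge (hu0 n) hn1.le ?_
                have h4 := h i j hb
                rw [← le_div_iff₀ hβ] at h4
                rw [add_div, mul_div_cancel_left₀ _ hβ.ne'] at h4
                exact h4)
        simp only [hf.fix_zero, zero_mul, sub_zero] at h1
        rw [← skew_iterate_succ_snd (p := p) (q := q)] at h1
        simp only [hY]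
        rw [div_le_iff₀ hρ]
        refine h1.trans (le_of_eq ?_)
        field_simp
      have hBu : 0 < B / ρ * u n ^ ((δ : ℝ) * κ) :=
        mul_pos (div_pos hB hρ) (Real.rpow_pos_of_pos (hu0 n) _)
      have h5 : u (n + 1) ≤ max (B / ρ * u n ^ ((δ : ℝ) * κ)) (X (n + 1) ^ β) :=
        max_le_max hle le_rfl
      rcases le_max_iff.1 h5 with h5 | h5
      · refine (min_le_left _ _).trans ?_
        have h6 := Real.log_le_log (hu0 _) h5
        rw [Real.log_mul (div_pos hB hρ).ne' (Real.rpow_pos_of_pos (hu0 n) _).ne',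
          Real.log_rpow (hu0 n)] at h6
        have h7 : Real.log (B / ρ) ≤ C' := le_max_right _ _
        linarith
      · exact (min_le_right _ _).trans (neg_le_neg (Real.log_le_log (hu0 _) h5)))
    (by
      filter_upwards [hC] with n hn
      refine le_trans ?_ (le_max_left _ _)
      rw [Real.log_rpow (hX0 _), Real.log_rpow (hX0 _), hlogX, hlogX]
      have e : -(β * (Real.log ‖p^[n + 1] x.1‖ - Real.log ρ)) -
          δ * -(β * (Real.log ‖p^[n] x.1‖ - Real.log ρ))
          = -(β * ((Real.log ‖p^[n + 1] x.1‖ - δ * Real.log ‖p^[n] x.1‖) +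
            (δ - 1) * Real.log ρ)) := by ring
      rw [e, abs_neg, abs_mul, abs_of_pos hβ]
      refine mul_le_mul_of_nonneg_left ((abs_add_le _ _).trans ?_) hβ.le
      linarith)
  refine ⟨ρ / ρ ^ β, by positivity, ?_⟩
  filter_upwards [key] with n hn
  have h1 : u n = X n ^ β := Real.log_injOn_pos (hu0 n) (hXβ n) (neg_injective hn)
  have h2 : Y n ≤ X n ^ β := h1 ▸ le_max_left _ _
  simp only [hX, hY] at h2
  rw [div_le_iff₀ hρ, Real.div_rpow (norm_nonneg _) hρ.le] at h2
  refine h2.trans (le_of_eq ?_)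
  ring

theorem IsSuperattracting.tendsto_seqF_of_ne (hf : IsSuperattracting D p q a δ b) {α : ℝ} {d : ℕ}
    (hdδ : d < δ) (hα : 0 < α) (h : ∀ i j : ℕ, b i j ≠ 0 → α * δ ≤ i + α * j) (h0 : b 0 δ = 0)
    {x : ℂ × ℂ} (hx : Tendsto (fun n : ℕ => (skew p q)^[n] x) atTop (𝓝 0))
    (hne : ∀ n, p^[n] x.1 ≠ 0) :
    Tendsto (seqF p q δ d α x) atTop (𝓝 ((α : EReal) * greenP p δ x.1)) := by
  have hz : Tendsto (fun n : ℕ => p^[n] x.1) atTop (𝓝 0) := by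
    have := (continuous_fst.tendsto (0 : ℂ × ℂ)).comp hx
    simpa [Function.comp_def, skew_iterate_fst] using this
  obtain ⟨g, -, -, hg, -, hgreen⟩ := hf.tendsto_seqP_of_ne hz hne
  have hδ : (1 : ℝ) < δ := by exact_mod_cast hf.two_le
  have hz0 : ∀ n, 0 < ‖p^[n] x.1‖ := fun n => norm_pos_iff.2 (hne n)
  have hzα : ∀ n, 0 < ‖p^[n] x.1‖ ^ α := fun n => Real.rpow_pos_of_pos (hz0 n) α
  have hpos : ∀ n, 0 < max (‖p^[n] x.1‖ ^ α) ‖((skew p q)^[n] x).2‖ := fun n =>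
    (hzα n).trans_le (le_max_left _ _)
  rw [hgreen, ← EReal.coe_mul]
  unfold seqF
  simp only [max_eq_left hdδ.le, skew_iterate_fst]
  refine tendsto_mul_elog (Eventually.of_forall hpos) ?_
  refine tendsto_order.2 ⟨fun c hc => ?_, fun c hc => ?_⟩
  · filter_upwards [(hg.const_mul α).eventually (lt_mem_nhds hc)] with n hn
    refine hn.trans_le ?_
    have := Real.log_le_log (hzα n) (le_max_left _ ‖((skew p q)^[n] x).2‖)
    rw [Real.log_rpow (hz0 n)] at this
    rw [← mul_div_assoc]
    gcongr
  · -- choose `β < α` with `β * g < c`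
    obtain ⟨β, hβc, hβ, hβα⟩ : ∃ β, β * g < c ∧ 0 < β ∧ β < α := by
      have h1 : Tendsto (fun β : ℝ => β * g) (𝓝[<] α) (𝓝 (α * g)) :=
        ((continuous_mul_const g).tendsto α).mono_left nhdsWithin_le_nhds
      exact ((h1.eventually (gt_mem_nhds hc)).and
        ((eventually_nhdsWithin_of_eventually_nhds (lt_mem_nhds hα)).and
          self_mem_nhdsWithin)).exists
    obtain ⟨κ, hκ, hκb⟩ := exists_one_lt_mul_le (by linarith [hf.two_le]) hβ hβα h h0
    obtain ⟨K, hK, hev⟩ := hf.eventually_log_le hβ hκ hκb hx hne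
    have hlim : Tendsto (fun n : ℕ => Real.log K / (δ : ℝ) ^ n +
        β * (Real.log ‖p^[n] x.1‖ / (δ : ℝ) ^ n)) atTop (𝓝 (β * g)) := by
      have := ((tendsto_pow_atTop_atTop_of_one_lt hδ).const_div_atTop (Real.log K)).add
        (hg.const_mul β)
      rwa [zero_add] at this
    filter_upwards [(hg.const_mul α).eventually (gt_mem_nhds hc),
      hlim.eventually (gt_mem_nhds hβc), hev] with n hn1 hn2 hn3
    have hδn : (0 : ℝ) < (δ : ℝ) ^ n := by positivity
    rcases le_total ‖((skew p q)^[n] x).2‖ (‖p^[n] x.1‖ ^ α) with hle | hle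
    · rw [max_eq_left hle, Real.log_rpow (hz0 n), mul_div_assoc]
      exact hn1
    · rw [max_eq_right hle]
      refine lt_of_le_of_lt ?_ hn2
      have h2 := Real.log_le_log ((hzα n).trans_le hle) hn3
      rw [Real.log_mul hK.ne' (Real.rpow_pos_of_pos (hz0 n) β).ne', Real.log_rpow (hz0 n)] at h2
      rw [← mul_div_assoc, ← add_div]
      gcongr

/-- Once an orbit lands in `{z = 0}`, it converges to the origin faster than `exp (-c * δ ^ n)`
for every `c`, since `q (0, w) = O(w ^ (δ + 1))`. -/
theorem IsSuperattracting.tendsto_seqF_of_eq_zero (hf : IsSuperattracting D p q a δ b) {α : ℝ}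
    {d : ℕ} (hdδ : d < δ) (hα : 0 < α) (h : ∀ j : ℕ, b 0 j ≠ 0 → δ + 1 ≤ j)
    {x : ℂ × ℂ} (hx : Tendsto (fun n : ℕ => (skew p q)^[n] x) atTop (𝓝 0)) {N : ℕ}
    (hN : p^[N] x.1 = 0) : Tendsto (seqF p q δ d α x) atTop (𝓝 ⊥) := by
  obtain ⟨ρ, B, hρ, hρ1, hB, hq⟩ := exists_norm_sub_monomial_le hf.expand_q
  have hδ : (1 : ℝ) < δ := by exact_mod_cast hf.two_le
  have hδ0 : (0 : ℝ) < δ := by linarith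
  have hw : Tendsto (fun n : ℕ => ((skew p q)^[n] x).2) atTop (𝓝 0) := by
    have := (continuous_snd.tendsto (0 : ℂ × ℂ)).comp hx
    simpa [Function.comp_def] using this
  set Y : ℕ → ℝ := fun n => ‖((skew p q)^[n] x).2‖ / ρ with hY
  have hY0 : ∀ n, 0 ≤ Y n := fun n => by positivity
  have hYlim : Tendsto Y atTop (𝓝 0) := by simpa using hw.norm.div_const ρ
  have hsmall : ∀ᶠ n in atTop, Y n < 1 ∧ Y n ≤ Real.exp (-1) ∧
      B / ρ * Y n ^ (1 / 2 : ℝ) ≤ 1 := by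
    have h1 : Tendsto (fun n => B / ρ * Y n ^ (1 / 2 : ℝ)) atTop (𝓝 0) := by
      have := (hYlim.rpow_const (p := 1 / 2) (Or.inr (by norm_num))).const_mul (B / ρ)
      rwa [Real.zero_rpow (by norm_num), mul_zero] at this
    exact (hYlim.eventually (gt_mem_nhds one_pos)).and
      ((hYlim.eventually (ge_mem_nhds (Real.exp_pos _))).and
        (h1.eventually (ge_mem_nhds one_pos)))
  obtain ⟨N', hN'⟩ := eventually_atTop.1 (hsmall.and (eventually_ge_atTop N))
  -- an exponent between `δ` and `δ + 1`: the spare half power of `Y` absorbs the constant `B / ρ`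
  set E : ℝ := δ + 1 / 2 with hE
  have hE0 : 0 < E := by positivity
  have hstep : ∀ n ≥ N', Y (n + 1) ≤ Y n ^ E := by
    intro n hn
    obtain ⟨⟨h1, h2, h3⟩, h4⟩ := hN' n hn
    have hz : p^[n] x.1 = 0 := hf.iterate_eq_zero hN h4
    -- as `b 0 0 = 0`, removing the monomial `(0, 0)` does not change the series
    have h5 := hq ((skew p q)^[n] x) (by rw [skew_iterate_fst, hz]; simpa using hρ)
      ((div_lt_one hρ).1 h1) (0, 0) (Y n ^ (δ + 1)) (pow_nonneg (hY0 n) _) (fun i j hb _ => by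
        rw [skew_iterate_fst, hz, norm_zero, zero_div]
        change 0 ^ i * Y n ^ j ≤ _
        rcases Nat.eq_zero_or_pos i with rfl | hi
        · rw [pow_zero, one_mul]
          exact pow_le_pow_of_le_one (hY0 n) h1.le (h j hb)
        · rw [zero_pow hi.ne', zero_mul]
          exact pow_nonneg (hY0 n) _)
    simp only [hf.fix_zero, zero_mul, sub_zero] at h5
    rw [← skew_iterate_succ_snd (p := p) (q := q)] at h5
    have e : Y n ^ (δ + 1) = Y n ^ E * Y n ^ (1 / 2 : ℝ) := by
      rw [← Real.rpow_add_of_nonneg (hY0 n) hE0.le (by norm_num), ← Real.rpow_natCast]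
      congr 1
      rw [hE]
      push_cast
      ring
    calc Y (n + 1) ≤ B * Y n ^ (δ + 1) / ρ := by simp only [hY]; gcongr
      _ = Y n ^ E * (B / ρ * Y n ^ (1 / 2 : ℝ)) := by rw [e]; ring
      _ ≤ Y n ^ E := mul_le_of_le_one_right (Real.rpow_nonneg (hY0 n) _) h3
  have hdecay : ∀ n : ℕ, Y (n + N') ≤ Real.exp (-E ^ n) := by
    intro n
    induction n with
    | zero => simpa using (hN' N' le_rfl).1.2.1
    | succ n ih =>
      rw [show n + 1 + N' = n + N' + 1 by ring]
      refine (hstep _ (Nat.le_add_left _ _)).trans ?_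
      refine (Real.rpow_le_rpow (hY0 _) ih hE0.le).trans (le_of_eq ?_)
      rw [← Real.exp_mul, pow_succ, neg_mul]
  have hbot : Tendsto (fun n : ℕ => -((E / δ) ^ n / (δ : ℝ) ^ N')) atTop atBot :=
    tendsto_neg_atTop_atBot.comp ((tendsto_pow_atTop_atTop_of_one_lt
      ((one_lt_div hδ0).2 (by rw [hE]; linarith))).atTop_div_const (by positivity))
  refine (tendsto_add_atTop_iff_nat N').1 (EReal.tendsto_nhds_bot_iff_real.2 fun c => ?_)
  filter_upwards [hbot.eventually_lt_atBot c] with n hn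
  have hz : p^[n + N'] x.1 = 0 :=
    hf.iterate_eq_zero hN ((hN' N' le_rfl).2.trans (Nat.le_add_left _ _))
  have h1 : ‖((skew p q)^[n + N'] x).2‖ ≤ Real.exp (-E ^ n) := by
    have h2 := hdecay n
    simp only [hY] at h2
    rw [div_le_iff₀ hρ] at h2
    exact h2.trans (mul_le_of_le_one_right (Real.exp_pos _).le hρ1.le)
  rw [seqF, skew_iterate_fst, hz, norm_zero, Real.zero_rpow hα.ne', max_eq_right (norm_nonneg _),
    max_eq_left hdδ.le]
  refine (mul_elog_le (by positivity) h1).trans_lt ?_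
  rw [EReal.coe_lt_coe_iff]
  refine lt_of_eq_of_lt ?_ hn
  rw [div_pow, pow_add]
  field_simp

/-- On the basin of the origin the limit of `seqF` is `α G_p`. -/
theorem IsSuperattracting.tendsto_seqF (hf : IsSuperattracting D p q a δ b) {α : ℝ} {d : ℕ}
    (hdδ : d < δ) (hα : 0 < α) (h : ∀ i j : ℕ, b i j ≠ 0 → α * δ ≤ i + α * j) (h0 : b 0 δ = 0)
    {x : ℂ × ℂ} (hx : x ∈ basin D p q) :
    Tendsto (seqF p q δ d α x) atTop (𝓝 ((α : EReal) * greenP p δ x.1)) := by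
  by_cases hne : ∀ n, p^[n] x.1 ≠ 0
  · exact hf.tendsto_seqF_of_ne hdδ hα h h0 hx.2 hne
  · push Not at hne
    obtain ⟨N, hN⟩ := hne
    rw [(hf.tendsto_seqP_of_eq_zero hN).2, EReal.coe_mul_bot_of_pos hα]
    refine hf.tendsto_seqF_of_eq_zero hdδ hα (fun j hb => ?_) hx.2 hN
    have h1 := h 0 j hb
    rw [Nat.cast_zero, zero_add] at h1
    have h2 : δ ≤ j := by exact_mod_cast le_of_mul_le_mul_left h1 hα
    rcases h2.eq_or_lt with rfl | h2
    · exact absurd h0 hb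
    · exact h2

end Basin

end SkewProduct

/-! ### Limits at an interior vertex -/

theorem mainTheorem12 (D : Set ℂ) (p : ℂ → ℂ) (q : ℂ × ℂ → ℂ) (a : ℂ) (δ : ℕ) (b : ℕ → ℕ → ℂ)
    (hf : IsSuperattracting D p q a δ b)
    (s : ℕ) (n m : ℕ → ℕ) (hv : IsVertices b s n m)
    (hs : 2 < s) (k : ℕ) (hk : 2 ≤ k) (hks : k ≤ s - 1)
    (hδ : intercept n m k ≤ (δ : ℝ)) (hδ' : (δ : ℝ) ≤ intercept n m (k - 1))
    (γ d : ℕ) (hγd : (γ, d) = (n k, m k)) :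
    -- the limit `G_p` exists on `A_p`
    (∀ z ∈ basinP D p, Tendsto (seqP p δ z) atTop (𝓝 (greenP p δ z))) ∧
    -- `G_z` exists and equals `α G_p` on `A_f`
    ((2 ≤ d ∨ (intercept n m k < (δ : ℝ) ∧ (δ : ℝ) < intercept n m (k - 1))) →
      ∃ r₀ : ℝ, 0 < r₀ ∧ ∀ r : ℝ, 0 < r → r < r₀ →
        ∀ x ∈ preimages D p q (wedge (weightOne n m k) (weightTwo n m k) r),
          x.1 ∈ basinP D p ∧
          Tendsto (seqZ p q δ d x) atTop (𝓝 ((alpha γ d δ : EReal) * greenP p δ x.1))) ∧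
    -- `G_f ^ α` exists and equals `α G_p` on `A_0`
    ((n 1, m 1) ≠ (0, δ) →
      ∀ x ∈ basin D p q,
        Tendsto (seqF p q δ d (alpha γ d δ) x) atTop
          (𝓝 ((alpha γ d δ : EReal) * greenP p δ x.1))) := by
  obtain ⟨rfl, rfl⟩ := Prod.mk.inj hγd
  have hk₁ : 1 ≤ k - 1 := by omega
  have hk₂ : k - 1 + 1 = k := by omega
  have hks' : k + 1 ≤ s := by omega
  have hk1s : k - 1 + 1 ≤ s := by omega
  have hl₁ : 0 < weightOne n m k := hv.edgeWeight_pos hk₁ hk1s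
  have hl₂ : 0 < weightTwo n m k := hv.weightTwo_pos hk hks'
  have hsum : weightOne n m k + weightTwo n m k = edgeWeight n m k := by
    rw [weightTwo]; ring
  have hl : 0 < edgeWeight n m k := hv.edgeWeight_pos (by omega) hks'
  have hle : ∀ t : ℝ, weightOne n m k ≤ t → t ≤ edgeWeight n m k →
      ∀ i j : ℕ, b i j ≠ 0 → (n k : ℝ) + t * m k ≤ i + t * j := fun t h₁ h₂ i j hb =>
    hv.le_of_edgeWeight hk hks' h₁ h₂ (hl₁.trans_le h₁) hb
  have hi : edgeWeight n m k * intercept n m k = n k + edgeWeight n m k * m k :=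
    hv.edgeWeight_mul_intercept (by omega) hks'
  have hi' : weightOne n m k * intercept n m (k - 1) = n k + weightOne n m k * m k := by
    have := hv.edgeWeight_mul_intercept_succ hk₁ hk1s
    rwa [hk₂] at this
  have he₂ := mul_le_mul_of_nonneg_left hδ hl.le
  have he₁ := mul_le_mul_of_nonneg_left hδ' hl₁.le
  rw [hi] at he₂
  rw [hi'] at he₁
  have hd : 1 ≤ m k := by
    have := hv.strictAnti ⟨by omega, by omega⟩ ⟨by omega, hks'⟩ (Nat.lt_succ_self k)
    omega
  have hγ : 0 < n k := by
    have := hv.strictMono ⟨hk₁, by omega⟩ ⟨by omega, by omega⟩ (show k - 1 < k by omega)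
    omega
  have hγ' : (0 : ℝ) < n k := by exact_mod_cast hγ
  have hdδ' : (m k : ℝ) < δ :=
    lt_of_mul_lt_mul_left (by linarith : edgeWeight n m k * m k < edgeWeight n m k * δ) hl.le
  have hdδ : m k < δ := by exact_mod_cast hdδ'
  have hα : 0 < alpha (n k) (m k) δ := div_pos hγ' (by linarith)
  have hαeq : (n k : ℝ) + alpha (n k) (m k) δ * m k = alpha (n k) (m k) δ * δ := by
    have : alpha (n k) (m k) δ * (δ - m k) = n k := by
      rw [alpha, div_mul_cancel₀ _ (by linarith)]
    linarith
  have hα₁ : weightOne n m k ≤ alpha (n k) (m k) δ := by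
    rw [alpha, le_div_iff₀ (by linarith)]
    linarith
  have hα₂ : alpha (n k) (m k) δ ≤ edgeWeight n m k := by
    rw [alpha, div_le_iff₀ (by linarith)]
    linarith
  have hsupp : ∀ i j : ℕ, b i j ≠ 0 →
      alpha (n k) (m k) δ * δ ≤ i + alpha (n k) (m k) δ * j := by
    rw [← hαeq]
    exact hle _ hα₁ hα₂
  refine ⟨fun z hz => hf.tendsto_seqP hz, fun hstrict => ?_, fun hfirst x hx => ?_⟩
  · refine hf.tendsto_seqZ (hv.coeff_ne_zero (by omega) (by omega)) hd hdδ hl₁ hl₂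
      (hle _ le_rfl (hα₁.trans hα₂)) ?_ he₁ (by rwa [hsum]) ?_
    · rw [hsum]
      exact hle _ (hα₁.trans hα₂) le_rfl
    · refine hstrict.imp_right fun h => ⟨?_, ?_⟩
      · rw [← hi']
        exact mul_lt_mul_of_pos_left h.2 hl₁
      · rw [hsum, ← hi]
        exact mul_lt_mul_of_pos_left h.1 hl
  · refine hf.tendsto_seqF hdδ hα hsupp ?_ hx
    by_contra hb
    exact hfirst (hv.eq_first_vertex hα hsupp hb)
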